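/- Let $k$ be a (not necessarily commutative) ring and let $X$ be a connected, locally simply connected topological space with a universal covering $\phi\colon\widetilde X\to X$. Here a space is called simply connected if it is connected and all its coverings are trivial, it is locally simply connected if every point has a basis of simply connected open neighbourhoods, and a universal covering is a covering with simply connected total space. Let $\operatorname{Shv}_k(X)$ be the category of sheaves of $k$-modules on $X$, and let $\operatorname{Qcoh}_k(X)\subseteq\operatorname{Shv}_k(X)$ be the full subcategory of quasi-coherent sheaves, i.e. of those sheaves $F$ such that each point of $X$ has an open neighbourhood $U$ with an exact sequence $k_U^{\oplus I}\to k_U^{\oplus J}\to F|_U\to 0$ for some sets $I,J$ (equivalently here, locally constant sheaves); it is an abelian category. Then the inclusion $\operatorname{Qcoh}_k(X)\to\operatorname{Shv}_k(X)$ has a right adjoint $\operatorname{Qc}\colon\operatorname{Shv}_k(X)\to\operatorname{Qcoh}_k(X)$. Moreover, if $R^i\operatorname{Qc}$ denote the right derived functors of $\operatorname{Qc}$, then $X$ is $k$-aspherical, that is, $H^i(\widetilde X,M_{\widetilde X})=0$ for every $i>0$ and every $k$-module $M$ (with $M_{\widetilde X}$ the constant sheaf), if and only if $R^i\operatorname{Qc}(\mathcal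 L)=0$ for every $i>0$ and every quasi-coherent sheaf $\mathcal L$ on $X$. -/

import Mathlib

open CategoryTheory Limits TopologicalSpace Opposite
universe u

noncomputable section

namespace TopShv

/-- Sheaves of `k`-modules on the topological space `X`. -/
abbrev Shv (k : Type u) [Ring k] (X : TopCat.{u}) := TopCat.Sheaf (ModuleCat.{u} k) X

/-- The constant sheaf functor `M ↦ M_X`. -/
def constSheaf (k : Type u) [Ring k] (X : TopCat.{u}) : ModuleCat.{u} k ⥤ Shv k X :=
  constantSheaf (Opens.grothendieckTopology X) (ModuleCat.{u} k)

/-- The global sections functor `F ↦ Γ(X, F)`. -/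
def globalSections (k : Type u) [Ring k] (X : TopCat.{u}) : Shv k X ⥤ ModuleCat.{u} k :=
  TopCat.Sheaf.forget (ModuleCat.{u} k) X ⋙ (evaluation _ _).obj (op ⊤)

/-- The inverse image functor `f⁻¹`. -/
def invImage (k : Type u) [Ring k] {X Y : TopCat.{u}} (f : X ⟶ Y) : Shv k Y ⥤ Shv k X :=
  TopCat.Sheaf.pullback (ModuleCat.{u} k) f

/-- The restriction functor `F ↦ F|_U` to an open subset. -/
abbrev restrict (k : Type u) [Ring k] {X : TopCat.{u}} (U : Opens X) :
    Shv k X ⥤ Shv k ((Opens.toTopCat X).obj U) :=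
  invImage k U.inclusion'

/-- A sheaf of `k`-modules `F` is quasi-coherent if every point of `X` has an open neighbourhood `U`
with an exact sequence `k_U^{⊕ I} ⟶ k_U^{⊕ J} ⟶ F|_U ⟶ 0` of sheaves on `U`. -/
def IsQuasicoherent (k : Type u) [Ring k] (X : TopCat.{u}) : ObjectProperty (Shv k X) := fun F =>
  ∀ x : X, ∃ U : Opens X, x ∈ U ∧ ∃ (I J : Type u)
    (f : (∐ fun _ : I => (constSheaf k ((Opens.toTopCat X).obj U)).obj (ModuleCat.of k k)) ⟶
      (∐ fun _ : J => (constSheaf k ((Opens.toTopCat X).obj U)).obj (ModuleCat.of k k)))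
    (g : (∐ fun _ : J => (constSheaf k ((Opens.toTopCat X).obj U)).obj (ModuleCat.of k k)) ⟶
      (restrict k U).obj F)
    (w : f ≫ g = 0), (ShortComplex.mk f g w).Exact ∧ Epi g

variable (k : Type u) [Ring k]

def constAdj (X : TopCat.{u}) : constSheaf k X ⊣ globalSections k X :=
  constantSheafAdj (Opens.grothendieckTopology X) (ModuleCat.{u} k) (T := ⊤) isTerminalTop

instance (X : TopCat.{u}) : (constSheaf k X).IsLeftAdjoint := (constAdj k X).isLeftAdjoint
instance (X : TopCat.{u}) : (globalSections k X).Additive where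
instance (X : TopCat.{u}) : (constSheaf k X).Additive := (constAdj k X).left_adjoint_additive

instance (X : TopCat.{u}) : PreservesFiniteLimits (constSheaf k X) := by
  have : PreservesFiniteLimits
      (presheafToSheaf (Opens.grothendieckTopology X) (ModuleCat.{u} k)) := inferInstance
  exact comp_preservesFiniteLimits (Functor.const _) (presheafToSheaf _ _)

instance {X Y : TopCat.{u}} (f : X ⟶ Y) : (invImage k f).IsLeftAdjoint :=
  inferInstanceAs (TopCat.Sheaf.pullback (ModuleCat.{u} k) f).IsLeftAdjoint
instance {X Y : TopCat.{u}} (f : X ⟶ Y) : PreservesFiniteLimits (invImage k f) :=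
  Functor.sheafPullbackConstruction.preservesFiniteLimits (Opens.map f) (ModuleCat.{u} k) _ _

def invImageAdj {X Y : TopCat.{u}} (f : X ⟶ Y) :
    invImage k f ⊣ TopCat.Sheaf.pushforward (ModuleCat.{u} k) f :=
  TopCat.Sheaf.pullbackPushforwardAdjunction (ModuleCat.{u} k) f
instance {X Y : TopCat.{u}} (f : X ⟶ Y) : (TopCat.Sheaf.pushforward (ModuleCat.{u} k) f).Additive where
instance {X Y : TopCat.{u}} (f : X ⟶ Y) : (invImage k f).Additive := (invImageAdj k f).left_adjoint_additive

def invImageConst {X Y : TopCat.{u}} (f : X ⟶ Y) :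
    constSheaf k Y ⋙ invImage k f ≅ constSheaf k X :=
  Adjunction.leftAdjointUniq ((constAdj k Y).comp (invImageAdj k f)) (constAdj k X)

def invImageComp {X Y Z : TopCat.{u}} (f : X ⟶ Y) (g : Y ⟶ Z) :
    invImage k g ⋙ invImage k f ≅ invImage k (f ≫ g) :=
  Adjunction.leftAdjointUniq ((invImageAdj k g).comp (invImageAdj k f)) (invImageAdj k (f ≫ g))


lemma isIso_constAdj_unit (X : TopCat.{u}) [ConnectedSpace X] : IsIso (constAdj k X).unit := by
  rw [NatTrans.isIso_iff_isIso_app]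
  intro M
  rw [ConcreteCategory.isIso_iff_bijective]
  let J := Opens.grothendieckTopology X
  let P : (Opens X)ᵒᵖ ⥤ ModuleCat.{u} k := (Functor.const _).obj M
  let η := toSheafify J P
  have key : ∀ m : M, (constAdj k X).unit.app M m = η.app (op ⊤) m := fun m => rfl
  have hinj : ∀ (U : Opens X) (x : X), x ∈ U → ∀ m m' : M,
      η.app (op U) m = η.app (op U) m' → m = m' := by
    intro U x hx m m' h
    have h1 := Presheaf.equalizerSieve_mem J η (X := op U) m m' h
    obtain ⟨V, i, hV, -⟩ := h1 x hx
    exact hV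
  have hsec : ∀ (U V : Opens X) (i : V ⟶ U) (m : M),
      (sheafify J P).map i.op (η.app (op U) m) = η.app (op V) m := by
    intro U V i m
    rw [← NatTrans.naturality_apply η]
    rfl
  constructor
  · intro m m' h
    rw [key, key] at h
    obtain ⟨x⟩ := (inferInstance : Nonempty X)
    exact hinj ⊤ x trivial m m' h
  · intro s
    have h1 := Presheaf.imageSieve_mem J η (U := op ⊤) s
    have h2 : ∀ x : X, ∃ (V : Opens X) (_ : x ∈ V) (m : M),
        η.app (op V) m = (sheafify J P).map (homOfLE le_top : V ⟶ ⊤).op s := by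
      intro x
      obtain ⟨V, i, ⟨m, hm⟩, hxV⟩ := h1 x trivial
      exact ⟨V, hxV, m, hm⟩
    choose V hxV m hm using h2
    have hloc : IsLocallyConstant m := by
      rw [IsLocallyConstant.iff_exists_open]
      intro x
      refine ⟨V x, (V x).isOpen, hxV x, fun y hy => ?_⟩
      refine hinj (V x ⊓ V y) y ⟨hy, hxV y⟩ _ _ ?_
      have e1 := congrArg ((sheafify J P).map (homOfLE inf_le_left : V x ⊓ V y ⟶ V x).op) (hm x)
      have e2 := congrArg ((sheafify J P).map (homOfLE inf_le_right : V x ⊓ V y ⟶ V y).op) (hm y)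
      have hcomp : ∀ (U V : Opens X) (a : U ⟶ V) (t : (sheafify J P).obj (op ⊤)),
          (sheafify J P).map a.op ((sheafify J P).map (homOfLE le_top : V ⟶ ⊤).op t) =
            (sheafify J P).map (homOfLE le_top : U ⟶ ⊤).op t := by
        intro U V a t
        rw [← ConcreteCategory.comp_apply, ← Functor.map_comp]
        rfl
      have e1' := ((hsec _ _ _ _).symm.trans e1).trans (hcomp _ _ _ s)
      have e2' := ((hsec _ _ _ _).symm.trans e2).trans (hcomp _ _ _ s)
      exact e2'.trans e1'.symm
    obtain ⟨x0⟩ := (inferInstance : Nonempty X)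
    refine ⟨m x0, ?_⟩
    rw [key]
    refine TopCat.Sheaf.eq_of_locally_eq' ((constSheaf k X).obj M) V ⊤
      (fun x => homOfLE le_top) ?_ _ _ ?_
    · intro x _
      exact Opens.mem_iSup.2 ⟨x, hxV x⟩
    · intro x
      refine (hsec ⊤ (V x) (homOfLE le_top) (m x0)).trans ?_
      rw [hloc.apply_eq_of_preconnectedSpace x0 x]
      exact hm x

def constFullyFaithful (X : TopCat.{u}) [ConnectedSpace X] : (constSheaf k X).FullyFaithful :=
  haveI := isIso_constAdj_unit k X
  (constAdj k X).fullyFaithfulLOfIsIsoUnit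

section general
variable {C D : Type*} [Category* C] [Category* D] [Abelian C] [Abelian D] {L : C ⥤ D}

lemma essImage_kernel [L.PreservesZeroMorphisms] [PreservesFiniteLimits L] (hL : L.FullyFaithful)
    {X Y : D} (f : X ⟶ Y)
    (hX : L.essImage X) (hY : L.essImage Y) : L.essImage (kernel f) := by
  obtain ⟨A, ⟨a⟩⟩ := hX
  obtain ⟨B, ⟨b⟩⟩ := hY
  refine ⟨kernel (hL.preimage (a.hom ≫ f ≫ b.inv)), ⟨PreservesKernel.iso L _ ≪≫
    kernel.mapIso _ _ a b ?_⟩⟩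
  simp

lemma essImage_cokernel [L.PreservesZeroMorphisms] [PreservesFiniteColimits L]
    (hL : L.FullyFaithful) {X Y : D} (f : X ⟶ Y)
    (hX : L.essImage X) (hY : L.essImage Y) : L.essImage (cokernel f) := by
  obtain ⟨A, ⟨a⟩⟩ := hX
  obtain ⟨B, ⟨b⟩⟩ := hY
  refine ⟨cokernel (hL.preimage (a.hom ≫ f ≫ b.inv)), ⟨PreservesCokernel.iso L _ ≪≫
    cokernel.mapIso _ _ a b ?_⟩⟩
  simp

lemma essImage_prod [PreservesFiniteLimits L] {X Y : D}
    (hX : L.essImage X) (hY : L.essImage Y) : L.essImage (X ⨯ Y) := by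
  obtain ⟨A, ⟨a⟩⟩ := hX
  obtain ⟨B, ⟨b⟩⟩ := hY
  exact ⟨A ⨯ B, ⟨PreservesLimitPair.iso L A B ≪≫ prod.mapIso a b⟩⟩

lemma exists_presentation_map [L.PreservesZeroMorphisms] [PreservesFiniteLimits L]
    [PreservesFiniteColimits L] {P Q M : C} {f : P ⟶ Q} {g : Q ⟶ M} {w : f ≫ g = 0}
    (hex : (ShortComplex.mk f g w).Exact) (hg : Epi g) {P' Q' M' : D}
    (a : P' ≅ L.obj P) (b : Q' ≅ L.obj Q) (e : L.obj M ≅ M') :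
    ∃ (f' : P' ⟶ Q') (g' : Q' ⟶ M') (w' : f' ≫ g' = 0),
      (ShortComplex.mk f' g' w').Exact ∧ Epi g' := by
  have hw : L.map f ≫ L.map g = 0 := by rw [← L.map_comp, w, L.map_zero]
  have h1 : a.hom ≫ L.map f = (a.hom ≫ L.map f ≫ b.inv) ≫ b.hom := by simp
  have h2 : b.hom ≫ L.map g = (b.hom ≫ L.map g ≫ e.hom) ≫ e.inv := by simp
  refine ⟨a.hom ≫ L.map f ≫ b.inv, b.hom ≫ L.map g ≫ e.hom, by simp [reassoc_of% hw], ?_, ?_⟩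
  · exact (ShortComplex.exact_iff_of_iso (ShortComplex.isoMk a b e.symm h1 h2)).2
      (hex.map L)
  · have : Epi (L.map g) := inferInstance
    infer_instance

end general

/-- `F` is locally constant: every point has an open neighbourhood on which `F` is constant. -/
def IsLocConst (X : TopCat.{u}) : ObjectProperty (Shv k X) := fun F =>
  ∀ x : X, ∃ U : Opens X, x ∈ U ∧ (constSheaf k _).essImage ((restrict k U).obj F)

lemma essImage_invImage {X Y : TopCat.{u}} (f : X ⟶ Y) {F : Shv k Y}
    (h : (constSheaf k Y).essImage F) : (constSheaf k X).essImage ((invImage k f).obj F) := by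
  obtain ⟨M, ⟨e⟩⟩ := h
  exact ⟨M, ⟨((invImageConst k f).app M).symm ≪≫ (invImage k f).mapIso e⟩⟩

/-- Restricting in two steps. -/
def restrictRestrict {X : TopCat.{u}} {U V : Opens X} (h : V ≤ U) (F : Shv k X) :
    (invImage k ((Opens.toTopCat X).map (homOfLE h))).obj ((restrict k U).obj F) ≅
      (restrict k V).obj F :=
  (invImageComp k _ U.inclusion').app F

lemma essImage_restrict_of_le {X : TopCat.{u}} {U V : Opens X} (h : V ≤ U) {F : Shv k X}
    (hF : (constSheaf k _).essImage ((restrict k U).obj F)) :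
    (constSheaf k _).essImage ((restrict k V).obj F) :=
  Functor.essImage.ofIso (restrictRestrict k h F) (essImage_invImage k _ hF)

lemma exists_connected {X : TopCat.{u}} [LocallyConnectedSpace X] (U : Opens X) (x : X)
    (hx : x ∈ U) : ∃ V : Opens X, V ≤ U ∧ x ∈ V ∧ ConnectedSpace ((Opens.toTopCat X).obj V) := by
  obtain ⟨V, ⟨h1, h2, h3⟩, h4⟩ := (locallyConnectedSpace_iff_hasBasis_isOpen_isConnected.1
    ‹_› x).mem_iff.1 (U.isOpen.mem_nhds hx)
  exact ⟨⟨V, h1⟩, h4, h2, isConnected_iff_connectedSpace.1 h3⟩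

lemma preservesCoproducts_const (X : TopCat.{u}) : PreservesColimitsOfSize.{u, u} (constSheaf k X) :=
  (constAdj k X).leftAdjoint_preservesColimits

/-- The coproduct of constant sheaves is constant. -/
def sigmaConstIso (X : TopCat.{u}) (I : Type u) (M : ModuleCat.{u} k) :
    (∐ fun _ : I => (constSheaf k X).obj M) ≅ (constSheaf k X).obj (∐ fun _ : I => M) :=
  haveI := preservesCoproducts_const k X
  (PreservesCoproduct.iso (constSheaf k X) (fun _ : I => M)).symm

/-- Every `k`-module is a quotient of a free `k`-module. -/
lemma exists_epi_free (N : ModuleCat.{u} k) :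
    ∃ (I : Type u) (p : (∐ fun _ : I => ModuleCat.of k k) ⟶ N), Epi p := by
  refine ⟨N, Sigma.desc fun n => ModuleCat.ofHom (LinearMap.toSpanSingleton k N n), ?_⟩
  rw [ModuleCat.epi_iff_surjective]
  intro n
  refine ⟨Sigma.ι (fun _ : N => ModuleCat.of k k) n (1 : k), ?_⟩
  rw [← ConcreteCategory.comp_apply, Sigma.ι_desc]
  exact one_smul k n

/-- Every `k`-module is the cokernel of a morphism between free `k`-modules. -/
lemma exists_presentation (M : ModuleCat.{u} k) :
    ∃ (I J : Type u) (f : (∐ fun _ : I => ModuleCat.of k k) ⟶ (∐ fun _ : J => ModuleCat.of k k))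
      (g : (∐ fun _ : J => ModuleCat.of k k) ⟶ M) (w : f ≫ g = 0),
      (ShortComplex.mk f g w).Exact ∧ Epi g := by
  obtain ⟨J, g, hg⟩ := exists_epi_free k M
  obtain ⟨I, q, hq⟩ := exists_epi_free k (kernel g)
  have w : (q ≫ kernel.ι g) ≫ g = 0 := by simp
  refine ⟨I, J, q ≫ kernel.ι g, g, w, ?_, hg⟩
  rw [ShortComplex.exact_iff_epi_kernel_lift]
  have : kernel.lift g (q ≫ kernel.ι g) w = q := by
    rw [← cancel_mono (kernel.ι g)]; simp
  dsimp only
  rw [this]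
  exact hq

lemma IsLocConst.isQuasicoherent {X : TopCat.{u}} {F : Shv k X} (hF : IsLocConst k X F) :
    IsQuasicoherent k X F := by
  intro x
  obtain ⟨U, hxU, M, ⟨e⟩⟩ := hF x
  obtain ⟨I, J, f, g, w, hex, hg⟩ := exists_presentation k M
  exact ⟨U, hxU, I, J, exists_presentation_map hex hg (sigmaConstIso k _ I (ModuleCat.of k k))
    (sigmaConstIso k _ J (ModuleCat.of k k)) e⟩

lemma IsQuasicoherent.isLocConst {X : TopCat.{u}} [LocallyConnectedSpace X] {F : Shv k X}
    (hF : IsQuasicoherent k X F) : IsLocConst k X F := by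
  intro x
  obtain ⟨U, hxU, I, J, f, g, w, hex, hepi⟩ := hF x
  obtain ⟨V, hVU, hxV, hV⟩ := exists_connected U x hxU
  refine ⟨V, hxV, ?_⟩
  let r := invImage k ((Opens.toTopCat X).map (homOfLE hVU))
  have hcoker : IsColimit (CokernelCofork.ofπ g w) := hex.gIsCokernel
  have e1 : cokernel f ≅ (restrict k U).obj F :=
    (colimit.isColimit _).coconePointUniqueUpToIso hcoker
  have e2 : cokernel (r.map f) ≅ (restrict k V).obj F :=
    (PreservesCokernel.iso r f).symm ≪≫ r.mapIso e1 ≪≫ restrictRestrict k hVU F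
  have hc (I : Type u) : (constSheaf k _).essImage
      (∐ fun _ : I => (constSheaf k ((Opens.toTopCat X).obj U)).obj (ModuleCat.of k k)) :=
    ⟨_, ⟨(sigmaConstIso k _ I _).symm⟩⟩
  exact Functor.essImage.ofIso e2 (essImage_cokernel (constFullyFaithful k _) _
    (essImage_invImage k _ (hc I)) (essImage_invImage k _ (hc J)))

lemma isQuasicoherent_iff_isLocConst {X : TopCat.{u}} [LocallyConnectedSpace X] (F : Shv k X) :
    IsQuasicoherent k X F ↔ IsLocConst k X F :=
  ⟨fun h => h.isLocConst, fun h => h.isQuasicoherent⟩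

section closure
variable (X : TopCat.{u}) [LocallyConnectedSpace X]

lemma exists_common {F G : Shv k X} (hF : IsQuasicoherent k X F) (hG : IsQuasicoherent k X G)
    (x : X) : ∃ V : Opens X, x ∈ V ∧ ConnectedSpace ((Opens.toTopCat X).obj V) ∧
      (constSheaf k _).essImage ((restrict k V).obj F) ∧
      (constSheaf k _).essImage ((restrict k V).obj G) := by
  obtain ⟨U, hxU, hU⟩ := hF.isLocConst k x
  obtain ⟨U', hxU', hU'⟩ := hG.isLocConst k x
  obtain ⟨V, hVU, hxV, hV⟩ := exists_connected (U ⊓ U') x ⟨hxU, hxU'⟩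
  exact ⟨V, hxV, hV, essImage_restrict_of_le k (hVU.trans inf_le_left) hU,
    essImage_restrict_of_le k (hVU.trans inf_le_right) hU'⟩

instance : (IsQuasicoherent k X).IsClosedUnderKernels where
  kernels_le := by
    rintro _ ⟨f, c, hc, hF, hG⟩
    refine IsLocConst.isQuasicoherent k fun x => ?_
    obtain ⟨V, hxV, hV, h1, h2⟩ := exists_common k X hF hG x
    refine ⟨V, hxV, ?_⟩
    have e : kernel f ≅ c.pt := (limit.isLimit _).conePointUniqueUpToIso hc
    exact Functor.essImage.ofIso ((PreservesKernel.iso (restrict k V) f).symm ≪≫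
      (restrict k V).mapIso e) (essImage_kernel (constFullyFaithful k _) _ h1 h2)

instance : (IsQuasicoherent k X).IsClosedUnderCokernels where
  cokernels_le := by
    rintro _ ⟨f, c, hc, hF, hG⟩
    refine IsLocConst.isQuasicoherent k fun x => ?_
    obtain ⟨V, hxV, hV, h1, h2⟩ := exists_common k X hF hG x
    refine ⟨V, hxV, ?_⟩
    have e : cokernel f ≅ c.pt := (colimit.isColimit _).coconePointUniqueUpToIso hc
    exact Functor.essImage.ofIso ((PreservesCokernel.iso (restrict k V) f).symm ≪≫
      (restrict k V).mapIso e) (essImage_cokernel (constFullyFaithful k _) _ h1 h2)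

instance : (IsQuasicoherent k X).IsClosedUnderIsomorphisms where
  of_iso {F G} e hF := by
    refine IsLocConst.isQuasicoherent k fun x => ?_
    obtain ⟨V, hxV, hV, h1, h2⟩ := exists_common k X hF hF x
    exact ⟨V, hxV, Functor.essImage.ofIso ((restrict k V).mapIso e) h1⟩

open scoped ZeroObject in
instance : (IsQuasicoherent k X).ContainsZero where
  exists_zero := by
    refine ⟨0, isZero_zero _, IsLocConst.isQuasicoherent k fun x => ⟨⊤, trivial, 0, ⟨?_⟩⟩⟩
    exact ((isZero_zero _).of_iso (constSheaf k _).mapZeroObject).iso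
      ((isZero_zero _).of_iso (restrict k _).mapZeroObject)

instance : (IsQuasicoherent k X).IsClosedUnderFiniteProducts := by
  have : (IsQuasicoherent k X).IsClosedUnderBinaryProducts := by
    refine ⟨?_⟩
    rintro P ⟨p⟩
    refine IsLocConst.isQuasicoherent k fun x => ?_
    obtain ⟨V, hxV, hV, h1, h2⟩ := exists_common k X (p.prop_diag_obj ⟨.left⟩) (p.prop_diag_obj ⟨.right⟩) x
    refine ⟨V, hxV, ?_⟩
    have e : (p.diag.obj ⟨.left⟩ ⨯ p.diag.obj ⟨.right⟩) ≅ P :=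
      HasLimit.isoOfNatIso (diagramIsoPair p.diag).symm ≪≫
      (limit.isLimit _).conePointUniqueUpToIso p.isLimit
    exact Functor.essImage.ofIso ((PreservesLimitPair.iso (restrict k V) _ _).symm ≪≫
      (restrict k V).mapIso e) (essImage_prod h1 h2)
  exact .mk'

end closure

/-- The category `Qcoh_k(X)` of quasi-coherent sheaves, a full subcategory of `Shv_k(X)`. -/
abbrev Qcoh (X : TopCat.{u}) := (IsQuasicoherent k X).FullSubcategory

/-- The inclusion `i : Qcoh_k(X) ⥤ Shv_k(X)`. -/
abbrev qcohInclusion (X : TopCat.{u}) : Qcoh k X ⥤ Shv k X := (IsQuasicoherent k X).ι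

instance (X : TopCat.{u}) [LocallyConnectedSpace X] : Abelian (Qcoh k X) := inferInstance

/-- The right derived functors `R^i Qc : Shv_k(X) ⥤ Qcoh_k(X)` of a right adjoint `Qc` of the
inclusion `Qcoh_k(X) ⥤ Shv_k(X)`. -/
def rightDerivedQc {k : Type u} [Ring k] {X : TopCat.{u}} [LocallyConnectedSpace X]
    {Qc : Shv k X ⥤ Qcoh k X} (adj : qcohInclusion k X ⊣ Qc) (i : ℕ) : Shv k X ⥤ Qcoh k X :=
  haveI : Qc.Additive := adj.right_adjoint_additive
  Qc.rightDerived i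

/-- A space is simply connected if it is connected (in particular nonempty) and all of its
coverings are trivial. -/
structure IsSimplyConn (Y : Type u) [TopologicalSpace Y] : Prop where
  connectedSpace : ConnectedSpace Y
  trivial_of_isCoveringMap : ∀ (E : Type u) [TopologicalSpace E] (p : E → Y), IsCoveringMap p →
    ∃ (I : Type u) (_ : TopologicalSpace I) (_ : DiscreteTopology I) (h : E ≃ₜ Y × I),
      ∀ e : E, (h e).1 = p e

/-- A space is locally simply connected if every point has a basis of neighbourhoods consisting
of simply connected open sets. -/
class LocallySimplyConnectedSpace (X : Type u) [TopologicalSpace X] : Prop where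
  exists_isSimplyConn : ∀ (x : X) (U : Opens X), x ∈ U →
    ∃ V : Opens X, x ∈ V ∧ V ≤ U ∧ IsSimplyConn V

instance (X : Type u) [TopologicalSpace X] [LocallySimplyConnectedSpace X] :
    LocallyConnectedSpace X := by
  rw [locallyConnectedSpace_iff_subsets_isOpen_isConnected]
  intro x U hU
  obtain ⟨W, hWU, hW, hxW⟩ := mem_nhds_iff.1 hU
  obtain ⟨V, hxV, hVW, hV⟩ :=
    LocallySimplyConnectedSpace.exists_isSimplyConn x (⟨W, hW⟩ : Opens X) hxW
  exact ⟨V, subset_trans hVW hWU, V.isOpen, hxV,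
    isConnected_iff_connectedSpace.2 hV.connectedSpace⟩

/-- A universal covering of `X`: a covering `φ : X' ⟶ X` with `X'` simply connected. -/
structure IsUniversalCovering {X' X : TopCat.{u}} (φ : X' ⟶ X) : Prop where
  isCoveringMap : IsCoveringMap φ
  isSimplyConn : IsSimplyConn X'

/-- Sheaf cohomology `H^i(X, F)`, the right derived functors of the global sections functor on
`Shv_k(X)`. -/
def cohomology {X : TopCat.{u}} (i : ℕ) (F : Shv k X) : ModuleCat.{u} k :=
  ((globalSections k X).rightDerived i).obj F

/-- The space `X` with universal covering `φ : X' ⟶ X` is `k`-aspherical if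
`H^i(X', M_{X'}) = 0` for all `i > 0` and all constant sheaves of `k`-modules `M_{X'}` on `X'`. -/
def IsAspherical {X' X : TopCat.{u}} (_φ : X' ⟶ X) : Prop :=
  ∀ (i : ℕ), 0 < i → ∀ M : ModuleCat.{u} k, IsZero (cohomology k i ((constSheaf k X').obj M))

end TopShv

end

/-! Write `φ : E ⟶ X` for the universal covering. Everything is read off from the functor
`liftSections`, L ↦ Γ(E, φ⁻¹L), on quasi-coherent sheaves. Because E is simply connected, φ⁻¹L is
constant, so this functor is faithful (`IsUniversalCovering.faithful`) and exact
(`IsUniversalCovering.preservesHomology`). It also has a left adjoint M ↦ φ_!(M_E): extension by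
zero along a local homeomorphism is left adjoint to φ⁻¹ (`extZeroAdj`), and along a covering it
makes a constant sheaf locally constant (`isQuasicoherent_extZero`).

Existence of Qc: by faithfulness φ_!(k_E) is a separator of Qcoh. Since X is locally simply
connected, each point has a neighbourhood on which all quasi-coherent sheaves are constant at once,
so Qcoh is closed under small colimits of sheaves. The special adjoint functor theorem then applies
to the inclusion.

Derived functors: `liftSections` after Qc and F ↦ Γ(E, φ⁻¹F) are right adjoint to the same functor M
↦ φ_!(M_E), hence isomorphic. As `liftSections` is exact, and φ⁻¹ is exact and preserves injectives
(its left adjoint φ_! preserves monomorphisms), `liftSections` sends RⁱQc(F) to Hⁱ(E, φ⁻¹F). By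
faithfulness one vanishes exactly when the other does. The equivalence follows because the sheaves
φ⁻¹L with L quasi-coherent are, up to isomorphism, precisely the constant sheaves on E.

Local constancy is handled through `ConnConst`, a condition on presheaves that can be checked before
sheafifying. -/

noncomputable section

/-! ### Presheaves that are constant along connected open sets -/

namespace TopShv

variable (k : Type u) [Ring k]

variable {k} in
/-- A presheaf is constant along the connected open subsets of `V`. -/
def ConnConst {X : TopCat.{u}} (P : (Opens X)ᵒᵖ ⥤ ModuleCat.{u} k) (V : Opens X) : Prop :=
  ∀ ⦃A B : Opens X⦄ (h : B ≤ A), A ≤ V → IsConnected (A : Set X) → IsConnected (B : Set X) →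
    IsIso (P.map (homOfLE h).op)

section
variable {k} {X : TopCat.{u}}

lemma ConnConst.mono {P : (Opens X)ᵒᵖ ⥤ ModuleCat.{u} k} {V W : Opens X} (hP : ConnConst P V)
    (h : W ≤ V) : ConnConst P W :=
  fun _ _ hBA hA => hP hBA (hA.trans h)

lemma ConnConst.of_iso {P Q : (Opens X)ᵒᵖ ⥤ ModuleCat.{u} k} (e : P ≅ Q) {V : Opens X}
    (hP : ConnConst P V) : ConnConst Q V := fun A B h hA hA' hB => by
  have := hP h hA hA' hB
  rw [show Q.map (homOfLE h).op = e.inv.app _ ≫ P.map (homOfLE h).op ≫ e.hom.app _ by simp]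
  infer_instance

lemma connConst_const (M : ModuleCat.{u} k) (V : Opens X) :
    ConnConst ((Functor.const (Opens X)ᵒᵖ).obj M) V := fun _ _ _ _ _ _ => by
  dsimp; infer_instance

lemma exists_isConnected_le [LocallyConnectedSpace X] (U : Opens X) (x : X) (hx : x ∈ U) :
    ∃ V : Opens X, V ≤ U ∧ x ∈ V ∧ IsConnected (V : Set X) := by
  obtain ⟨V, h1, h2, h3⟩ := exists_connected U x hx
  exact ⟨V, h1, h2, isConnected_iff_connectedSpace.2 h3⟩

lemma isBasis_isConnected [LocallyConnectedSpace X] :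
    Opens.IsBasis (Set.range fun V : {V : Opens X // IsConnected (V : Set X)} => V.1) := by
  rw [Opens.isBasis_iff_nbhd]
  intro U x hx
  obtain ⟨V, h1, h2, h3⟩ := exists_isConnected_le U x hx
  exact ⟨V, ⟨⟨V, h3⟩, rfl⟩, h2, h1⟩

lemma map_map_apply (P : (Opens X)ᵒᵖ ⥤ ModuleCat.{u} k) {U V W : Opens X} (h : V ≤ U) (h' : W ≤ V)
    (s : P.obj (op U)) :
    P.map (homOfLE h').op (P.map (homOfLE h).op s) = P.map (homOfLE (h'.trans h)).op s := by
  rw [← ConcreteCategory.comp_apply, ← Functor.map_comp]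
  rfl

lemma app_map_apply {P Q : (Opens X)ᵒᵖ ⥤ ModuleCat.{u} k} (η : P ⟶ Q) {U V : Opens X} (h : V ≤ U)
    (s : P.obj (op U)) :
    Q.map (homOfLE h).op (η.app _ s) = η.app _ (P.map (homOfLE h).op s) :=
  (NatTrans.naturality_apply η _ _).symm

/-- A locally bijective morphism to a sheaf is bijective on the connected open sets along which
the source is constant. -/
lemma ConnConst.isIso_app [LocallyConnectedSpace X] {P : (Opens X)ᵒᵖ ⥤ ModuleCat.{u} k}
    {V : Opens X} (hP : ConnConst P V) {F : Shv k X} (η : P ⟶ F.obj)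
    (hη : (Opens.grothendieckTopology X).W η)
    {A : Opens X} (hAV : A ≤ V) (hA : IsConnected (A : Set X)) : IsIso (η.app (op A)) := by
  have := (Opens.grothendieckTopology X).W_iff_isLocallyBijective η |>.1 hη
  obtain ⟨h1, h2⟩ := this
  rw [ConcreteCategory.isIso_iff_bijective]
  have hinj : ∀ B : Opens X, B ≤ V → IsConnected (B : Set X) → ∀ m m' : P.obj (op B),
      η.app (op B) m = η.app (op B) m' → m = m' := by
    intro B hBV hB m m' h
    have h1 := Presheaf.equalizerSieve_mem (Opens.grothendieckTopology X) η (X := op B) m m' h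
    obtain ⟨x, hx⟩ := hB.nonempty
    obtain ⟨W, i, hW, hxW⟩ := h1 x hx
    obtain ⟨C, hCW, hxC, hC⟩ := exists_isConnected_le W x hxW
    have := hP (hCW.trans (leOfHom i)) hBV hB hC
    refine ((ConcreteCategory.isIso_iff_bijective _).1 this).1 ?_
    have := congrArg (P.map (homOfLE hCW).op) hW
    exact (map_map_apply P (leOfHom i) hCW m).symm.trans
      (this.trans (map_map_apply P (leOfHom i) hCW m'))
  refine ⟨hinj A hAV hA, fun s => ?_⟩
  -- A local lift of `s` over `B` extends to `A`, since `P(A) → P(B)` is an isomorphism. All lifts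
  -- `m x` thus live in the single module `P(A)` and can be compared.
  have h3 : ∀ x : A, ∃ (B : Opens X) (_ : x.1 ∈ B) (_ : IsConnected (B : Set X)) (hBA : B ≤ A)
      (m : P.obj (op A)), η.app (op B) (P.map (homOfLE hBA).op m) = F.obj.map (homOfLE hBA).op s := by
    rintro ⟨x, hx⟩
    obtain ⟨W, i, ⟨m, hm⟩, hxW⟩ := Presheaf.imageSieve_mem (Opens.grothendieckTopology X) η
      (U := op A) s x hx
    obtain ⟨B, hBW, hxB, hB⟩ := exists_isConnected_le W x hxW
    have := hP (hBW.trans (leOfHom i)) hAV hA hB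
    obtain ⟨m', hm'⟩ := ((ConcreteCategory.isIso_iff_bijective _).1 this).2
      (P.map (homOfLE hBW).op m)
    refine ⟨B, hxB, hB, hBW.trans (leOfHom i), m', ?_⟩
    rw [hm', ← app_map_apply, hm]
    exact map_map_apply F.obj (leOfHom i) hBW s
  choose B hxB hB hBA m hm using h3
  have e1 : ∀ (x : A) {C : Opens X} (hC : C ≤ B x),
      η.app (op C) (P.map (homOfLE (hC.trans (hBA x))).op (m x)) =
        F.obj.map (homOfLE (hC.trans (hBA x))).op s := by
    intro x C hC
    refine (congrArg _ (map_map_apply P (hBA x) hC (m x))).symm.trans ?_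
    refine (app_map_apply η hC _).symm.trans ?_
    exact (congrArg _ (hm x)).trans (map_map_apply F.obj (hBA x) hC s)
  -- Both `m x` and `m y` lift `s` over a connected `C` in `B x ⊓ B y`, where `η` is injective;
  -- restriction from `A` to `C` is injective too.
  have hloc : IsLocallyConstant m := by
    rw [IsLocallyConstant.iff_exists_open]
    intro x
    refine ⟨Subtype.val ⁻¹' (B x : Set X), (B x).isOpen.preimage continuous_subtype_val, hxB x,
      fun y hy => ?_⟩
    obtain ⟨C, hC, hyC, hC'⟩ := exists_isConnected_le (B x ⊓ B y) y.1 ⟨hy, hxB y⟩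
    have hCx := hC.trans inf_le_left
    have hCy := hC.trans inf_le_right
    have := hP (hCx.trans (hBA x)) hAV hA hC'
    refine ((ConcreteCategory.isIso_iff_bijective _).1 this).1
      (hinj C (hCx.trans ((hBA x).trans hAV)) hC' _ _ ?_)
    exact (e1 y hCy).trans (e1 x hCx).symm
  have : ConnectedSpace A := isConnected_iff_connectedSpace.1 hA
  obtain ⟨x0⟩ := (inferInstance : Nonempty A)
  refine ⟨m x0, TopCat.Sheaf.eq_of_locally_eq' F B A (fun x => homOfLE (hBA x)) ?_ _ _ ?_⟩
  · intro x hx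
    exact Opens.mem_iSup.2 ⟨⟨x, hx⟩, hxB _⟩
  · intro x
    rw [hloc.apply_eq_of_preconnectedSpace x0 x]
    exact (app_map_apply η (hBA x) (m x)).trans (hm x)

/-- By `ConnConst.isIso_app`, `P` and `F` have the same sections on connected open subsets of `V`.
This is how sheaves defined by sheafification are shown to be locally constant. -/
lemma ConnConst.of_W [LocallyConnectedSpace X] {P : (Opens X)ᵒᵖ ⥤ ModuleCat.{u} k}
    {V : Opens X} (hP : ConnConst P V) {F : Shv k X} (η : P ⟶ F.obj)
    (hη : (Opens.grothendieckTopology X).W η) : ConnConst F.obj V := by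
  intro A B h hA hA' hB
  have := hP h hA hA' hB
  have := hP.isIso_app η hη hA hA'
  have := hP.isIso_app η hη (h.trans hA) hB
  rw [show F.obj.map (homOfLE h).op = inv (η.app _) ≫ P.map (homOfLE h).op ≫ η.app _ by simp]
  infer_instance

lemma ConnConst.of_essImage [LocallyConnectedSpace X] {F : Shv k X}
    (hF : (constSheaf k X).essImage F) (V : Opens X) : ConnConst F.obj V := by
  obtain ⟨M, ⟨e⟩⟩ := hF
  refine ConnConst.of_iso ((sheafToPresheaf _ _).mapIso e) ?_
  exact (connConst_const M V).of_W (F := (constSheaf k X).obj M) (toSheafify _ _)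
    (GrothendieckTopology.W_toSheafify _ _)

lemma isIso_of_isIso_app_isConnected [LocallyConnectedSpace X] {F G : Shv k X} (f : F ⟶ G)
    (h : ∀ V : Opens X, IsConnected (V : Set X) → IsIso (f.hom.app (op V))) : IsIso f :=
  TopCat.Sheaf.isIso_iff_isIso_basis isBasis_isConnected fun V => h V.1 V.2

/-- The counit from the constant sheaf on Γ(X, F) is an isomorphism on global sections, and both
sheaves have the same sections on a connected open set as on X. Connected open sets form a basis. -/
lemma ConnConst.essImage [LocallyConnectedSpace X] [ConnectedSpace X] {F : Shv k X}
    (hF : ConnConst F.obj ⊤) : (constSheaf k X).essImage F := by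
  have hX : IsConnected ((⊤ : Opens X) : Set X) := by
    simpa using isConnected_univ (α := X)
  let ε := (constAdj k X).counit.app F
  refine ⟨_, ⟨@asIso _ _ _ _ ε (isIso_of_isIso_app_isConnected ε fun V hV => ?_)⟩⟩
  let M := (globalSections k X).obj F
  have h1 := hF (le_top : V ≤ ⊤) le_rfl hX hV
  have h2 := ConnConst.of_essImage ⟨M, ⟨Iso.refl _⟩⟩ ⊤ (le_top : V ≤ ⊤) le_rfl hX hV
  -- Triangle identity: on global sections the counit is inverse to the unit, which is invertible
  -- because `X` is connected.
  have h3 : IsIso (ε.hom.app (op ⊤)) := by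
    have := isIso_constAdj_unit k X
    have : IsIso ((constAdj k X).unit.app ((globalSections k X).obj F)) :=
      NatIso.isIso_app_of_isIso _ _
    have h4 := (constAdj k X).right_triangle_components F
    exact @isIso_of_hom_comp_eq_id _ _ _ _ _ this _ h4
  have h5 := ε.hom.naturality (homOfLE (le_top : V ≤ ⊤)).op
  exact @IsIso.of_isIso_fac_left _ _ _ _ _ _ _ _ h2
    (@IsIso.comp_isIso _ _ _ _ _ _ _ h3 h1) h5

end

end TopShv

end

/-! ### Inverse image along an open map -/

noncomputable section

namespace TopShv

variable (k : Type u) [Ring k]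

section openmap
variable {X Y : TopCat.{u}} {f : X ⟶ Y} (hf : IsOpenMap f)

/-- The inverse image along an open map `f` is the sheafification of `U ↦ G (f '' U)`. -/
def invImageIsoOfIsOpenMap : invImage k f ≅ TopCat.Sheaf.forget (ModuleCat.{u} k) Y ⋙
    (Functor.whiskeringLeft _ _ _).obj hf.functor.op ⋙
      presheafToSheaf (Opens.grothendieckTopology X) (ModuleCat.{u} k) :=
  TopCat.Sheaf.pullbackIso (ModuleCat.{u} k) f ≪≫
    Functor.isoWhiskerLeft (TopCat.Sheaf.forget (ModuleCat.{u} k) Y)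
      (Functor.isoWhiskerRight (IsOpenMap.pullbackIso (C := ModuleCat.{u} k) hf) _)

/-- The canonical morphism from `U ↦ G (f '' U)` to the inverse image of `G`. -/
def toInvImage (G : Shv k Y) : hf.functor.op ⋙ G.obj ⟶ ((invImage k f).obj G).obj :=
  toSheafify (Opens.grothendieckTopology X) (hf.functor.op ⋙ G.obj) ≫
    ((invImageIsoOfIsOpenMap k hf).inv.app G).hom

lemma W_toInvImage (G : Shv k Y) : (Opens.grothendieckTopology X).W (toInvImage k hf G) := by
  have h2 : IsIso ((invImageIsoOfIsOpenMap k hf).inv.app G) := inferInstance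
  have := ((Opens.grothendieckTopology X).W_sheafToPresheaf_map_iff_isIso
    ((invImageIsoOfIsOpenMap k hf).inv.app G)).2 h2
  exact MorphismProperty.comp_mem _ _ _ (GrothendieckTopology.W_toSheafify _ _) this

lemma toInvImage_naturality {G G' : Shv k Y} (g : G ⟶ G') :
    Functor.whiskerLeft hf.functor.op g.hom ≫ toInvImage k hf G' =
      toInvImage k hf G ≫ ((invImage k f).map g).hom := by
  have h := congrArg (fun t => t.hom) ((invImageIsoOfIsOpenMap k hf).inv.naturality g)
  have h' := toSheafify_naturality (Opens.grothendieckTopology X)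
    (Functor.whiskerLeft hf.functor.op g.hom)
  dsimp only [toInvImage]
  refine (Category.assoc _ _ _).symm.trans ?_
  refine (congrArg (fun t => t ≫ ((invImageIsoOfIsOpenMap k hf).inv.app G').hom) h').trans ?_
  refine (Category.assoc _ _ _).trans ((congrArg (fun t => _ ≫ t) h).trans ?_)
  exact (Category.assoc _ _ _).symm

variable {k} in
lemma toInvImage_map_apply (G : Shv k Y) {U V : Opens X} (h : V ≤ U)
    (s : G.obj.obj (op (hf.functor.obj U))) :
    ((invImage k f).obj G).obj.map (homOfLE h).op ((toInvImage k hf G).app (op U) s) =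
      (toInvImage k hf G).app (op V)
        (G.obj.map (homOfLE (leOfHom (hf.functor.map (homOfLE h)))).op s) :=
  app_map_apply (toInvImage k hf G) h s

/-- Sections identified near each point of `U` agree on the images of small neighbourhoods, which
are open and cover `f '' U`. Injectivity of `f` plays no role here. -/
lemma toInvImage_app_injective (G : Shv k Y) (U : Opens X) :
    Function.Injective ((toInvImage k hf G).app (op U)) := by
  intro s s' h
  have hl := ((Opens.grothendieckTopology X).W_iff_isLocallyBijective _ |>.1
    (W_toInvImage k hf G)).1
  have h1 := Presheaf.equalizerSieve_mem (Opens.grothendieckTopology X) (toInvImage k hf G)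
    (X := op U) s s' h
  have h2 : ∀ x : U, ∃ (V : Opens X) (_ : x.1 ∈ V) (hV : V ≤ U),
      G.obj.map (homOfLE (leOfHom (hf.functor.map (homOfLE hV)))).op s =
        G.obj.map (homOfLE (leOfHom (hf.functor.map (homOfLE hV)))).op s' := by
    rintro ⟨x, hx⟩
    obtain ⟨V, i, hV, hxV⟩ := h1 x hx
    exact ⟨V, hxV, leOfHom i, hV⟩
  choose V hxV hVU hV using h2
  refine TopCat.Sheaf.eq_of_locally_eq' G (fun x => hf.functor.obj (V x)) (hf.functor.obj U)
    (fun x => homOfLE (leOfHom (hf.functor.map (homOfLE (hVU x))))) ?_ _ _ hV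
  rintro _ ⟨x, hx, rfl⟩
  exact Opens.mem_iSup.2 ⟨⟨x, hx⟩, x, hxV _, rfl⟩

/-- Local preimages of a section glue in `G` because `f` injective on `U` gives `f '' V ∩ f '' V' =
f '' (V ∩ V')`: no sheafification is needed over such `U`. -/
lemma isIso_toInvImage_app (G : Shv k Y) (U : Opens X) (hU : Set.InjOn f U) :
    IsIso ((toInvImage k hf G).app (op U)) := by
  rw [ConcreteCategory.isIso_iff_bijective]
  refine ⟨toInvImage_app_injective k hf G U, fun t => ?_⟩
  have hl := ((Opens.grothendieckTopology X).W_iff_isLocallyBijective _ |>.1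
    (W_toInvImage k hf G)).2
  have h2 : ∀ x : U, ∃ (V : Opens X) (_ : x.1 ∈ V) (hV : V ≤ U)
      (s : G.obj.obj (op (hf.functor.obj V))),
      (toInvImage k hf G).app (op V) s = ((invImage k f).obj G).obj.map (homOfLE hV).op t := by
    rintro ⟨x, hx⟩
    obtain ⟨V, i, ⟨s, hs⟩, hxV⟩ := Presheaf.imageSieve_mem (Opens.grothendieckTopology X)
      (toInvImage k hf G) (U := op U) t x hx
    exact ⟨V, hxV, leOfHom i, s, hs⟩
  choose V hxV hVU s hs using h2
  have hle : ∀ x, hf.functor.obj (V x) ≤ hf.functor.obj U := fun x =>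
    leOfHom (hf.functor.map (homOfLE (hVU x)))
  have e1 : ∀ (x : U) {C : Opens X} (hC : C ≤ V x),
      (toInvImage k hf G).app (op C)
        (G.obj.map (homOfLE (leOfHom (hf.functor.map (homOfLE hC)))).op (s x)) =
        ((invImage k f).obj G).obj.map (homOfLE (hC.trans (hVU x))).op t := by
    intro x C hC
    refine (toInvImage_map_apply hf G hC (s x)).symm.trans ?_
    exact (congrArg _ (hs x)).trans (map_map_apply ((invImage k f).obj G).obj (hVU x) hC t)
  have hcomp : TopCat.Presheaf.IsCompatible G.obj (fun x => hf.functor.obj (V x)) s := by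
    intro x y
    have e2 := toInvImage_app_injective k hf G (V x ⊓ V y)
      ((e1 x inf_le_left).trans (e1 y inf_le_right).symm)
    have hle2 : hf.functor.obj (V x) ⊓ hf.functor.obj (V y) ≤ hf.functor.obj (V x ⊓ V y) := by
      rintro _ ⟨⟨a, ha, rfl⟩, b, hb, hab⟩
      have : b = a := hU (hVU _ hb) (hVU _ ha) hab
      subst this
      exact ⟨b, ⟨ha, hb⟩, rfl⟩
    have e3 := congrArg (G.obj.map (homOfLE hle2).op) e2
    exact (map_map_apply G.obj _ _ _).symm.trans (e3.trans (map_map_apply G.obj _ _ _))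
  obtain ⟨r, hr, -⟩ := TopCat.Sheaf.existsUnique_gluing' G (fun x => hf.functor.obj (V x))
    (hf.functor.obj U) (fun x => homOfLE (hle x)) (by
      rintro _ ⟨x, hx, rfl⟩
      exact Opens.mem_iSup.2 ⟨⟨x, hx⟩, x, hxV _, rfl⟩) s hcomp
  refine ⟨r, ?_⟩
  refine TopCat.Sheaf.eq_of_locally_eq' ((invImage k f).obj G) V U
    (fun x => homOfLE (hVU x)) (fun x hx => Opens.mem_iSup.2 ⟨⟨x, hx⟩, hxV _⟩) _ _ fun x => ?_
  exact (toInvImage_map_apply hf G (hVU x) r).trans ((congrArg _ (hr x)).trans (hs x))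

end openmap

/-! ### Local constancy expressed through `ConnConst` -/

section restrict
variable {k} {X : TopCat.{u}} (U : Opens X)

lemma connConst_restrict_iff (F : Shv k X) (W : Opens ((Opens.toTopCat X).obj U)) :
    ConnConst ((restrict k U).obj F).obj W ↔
      ConnConst F.obj (U.isOpenEmbedding.isOpenMap.functor.obj W) := by
  have hj := U.isOpenEmbedding
  have hiso : ∀ A, IsIso ((toInvImage k (f := U.inclusion') hj.isOpenMap F).app (op A)) := fun A =>
    isIso_toInvImage_app k _ F A hj.injective.injOn
  have key : ∀ (A B : Opens ((Opens.toTopCat X).obj U)) (h : B ≤ A),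
      IsIso (F.obj.map (homOfLE (leOfHom (hj.isOpenMap.functor.map (homOfLE h)))).op) ↔
        IsIso (((restrict k U).obj F).obj.map (homOfLE h).op) := by
    intro A B h
    have hn := (toInvImage k (f := U.inclusion') hj.isOpenMap F).naturality (homOfLE h).op
    have hA := hiso A
    have hB := hiso B
    constructor
    · intro h1
      exact @IsIso.of_isIso_fac_left _ _ _ _ _ _ _ _ hA
        (@IsIso.comp_isIso _ _ _ _ _ _ _ h1 hB) hn.symm
    · intro h1
      exact @IsIso.of_isIso_fac_right _ _ _ _ _ _ _ _ hB
        (@IsIso.comp_isIso _ _ _ _ _ _ _ hA h1) hn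
  constructor
  · intro H A B h hA hA' hB
    -- Every open set below the image of `W` is itself an image, so `A` and `B` may be replaced by
    -- images and `key` applies.
    have hex : ∀ A ≤ hj.isOpenMap.functor.obj W, hj.isOpenMap.functor.obj
        ((Opens.map U.inclusion').obj A) = A := by
      intro A hA
      ext x
      constructor
      · rintro ⟨y, hy, rfl⟩; exact hy
      · intro hx
        obtain ⟨y, hy, rfl⟩ := hA hx
        exact ⟨y, hx, rfl⟩
    have e1 := hex A hA
    have e2 := hex B (h.trans hA)
    generalize hA0 : (Opens.map U.inclusion').obj A = A0 at e1
    generalize hB0 : (Opens.map U.inclusion').obj B = B0 at e2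
    have h0 : B0 ≤ A0 := by
      rw [← hA0, ← hB0]; exact leOfHom ((Opens.map _).map (homOfLE h))
    have hW : A0 ≤ W := by
      rw [← hA0]
      intro x hx
      obtain ⟨y, hy, hyx⟩ := hA hx
      exact hj.injective hyx ▸ hy
    have hconn : ∀ C : Opens ((Opens.toTopCat X).obj U),
        _root_.IsConnected (U.inclusion' '' (C : Set _)) → _root_.IsConnected (C : Set _) := fun C hC =>
      ⟨hC.1.of_image, hj.isInducing.isPreconnected_image.1 hC.2⟩
    clear hA0 hB0
    subst e1 e2
    exact (key A0 B0 h0).2 (H h0 hW (hconn _ hA')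
      (hconn _ hB))
  · intro H A B h hA hA' hB
    refine (key A B h).1 (H _ (leOfHom (hj.isOpenMap.functor.map (homOfLE hA))) ?_ ?_)
    · exact hA'.image _ hj.continuous.continuousOn
    · exact hB.image _ hj.continuous.continuousOn

lemma connConst_restrict_top_iff (F : Shv k X) :
    ConnConst ((restrict k U).obj F).obj ⊤ ↔ ConnConst F.obj U := by
  rw [connConst_restrict_iff]
  have : U.isOpenEmbedding.isOpenMap.functor.obj ⊤ = U := by
    ext x
    constructor
    · rintro ⟨y, -, rfl⟩; exact y.2
    · intro hx; exact ⟨⟨x, hx⟩, trivial, rfl⟩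
  rw [this]

instance [LocallyConnectedSpace X] : LocallyConnectedSpace ((Opens.toTopCat X).obj U) :=
  U.isOpen.locallyConnectedSpace

lemma isLocConst_iff_connConst [LocallyConnectedSpace X] (F : Shv k X) :
    IsLocConst k X F ↔ ∀ x : X, ∃ V : Opens X, x ∈ V ∧ ConnConst F.obj V := by
  constructor
  · intro h x
    obtain ⟨U, hx, hU⟩ := h x
    exact ⟨U, hx, (connConst_restrict_top_iff U F).1 (ConnConst.of_essImage hU ⊤)⟩
  · intro h x
    obtain ⟨V, hx, hV⟩ := h x
    obtain ⟨W, hWV, hxW, hW⟩ := exists_connected V x hx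
    exact ⟨W, hxW, ((connConst_restrict_top_iff W F).2 (hV.mono hWV)).essImage⟩

end restrict

end TopShv

end

/-! ### Étale spaces and sheaves on simply connected spaces -/

noncomputable section

namespace TopShv

variable {k : Type u} [Ring k]

section etale
variable {Y : TopCat.{u}}

/-- The stalk is a colimit over connected neighbourhoods inside `V`, along which all restriction
maps are isomorphisms. Such `V` are evenly covered by the étale space. -/
lemma ConnConst.bijective_germ [LocallyConnectedSpace Y] {F : TopCat.Presheaf (ModuleCat.{u} k) Y}
    {V : Opens Y} (hF : ConnConst F V) (hV : IsConnected (V : Set Y)) (y : Y) (hy : y ∈ V) :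
    Function.Bijective (F.germ V y hy) := by
  constructor
  · intro s s' h
    obtain ⟨W, hyW, i, i', h⟩ := F.germ_eq y hy hy s s' h
    obtain ⟨C, hCW, hyC, hC⟩ := exists_isConnected_le W y hyW
    have := hF (hCW.trans (leOfHom i)) le_rfl hV hC
    refine ((ConcreteCategory.isIso_iff_bijective _).1 this).1 ?_
    have := congrArg (F.map (homOfLE hCW).op) h
    exact (map_map_apply F (leOfHom i) hCW s).symm.trans
      (this.trans (map_map_apply F (leOfHom i) hCW s'))
  · intro t
    obtain ⟨W, hWV, hyW, s, hs⟩ := F.exists_le_germ_eq t hy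
    obtain ⟨C, hCW, hyC, hC⟩ := exists_isConnected_le W y hyW
    have := hF (hCW.trans hWV) le_rfl hV hC
    obtain ⟨r, hr⟩ := ((ConcreteCategory.isIso_iff_bijective _).1 this).2
      (F.map (homOfLE hCW).op s)
    refine ⟨r, ?_⟩
    rw [← TopCat.Presheaf.germ_res_apply F (homOfLE (hCW.trans hWV)) y hyC r, hr,
      TopCat.Presheaf.germ_res_apply, hs]

lemma continuous_etaleSection (F : TopCat.Presheaf (ModuleCat.{u} k) Y) {A : Opens Y}
    (s : F.obj (op A)) :
    Continuous fun x : A => (⟨x.1, F.germ A x.1 x.2 s⟩ : F.EtaleSpace) := by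
  refine continuous_generateFrom_iff.2 ?_
  rintro _ ⟨U, f, rfl⟩
  rw [isOpen_iff_mem_nhds]
  rintro ⟨x, hx⟩ ⟨hxU, h⟩
  obtain ⟨W, hxW, i, i', h⟩ := F.germ_eq x hx hxU s f h
  filter_upwards [(W.isOpen.preimage continuous_subtype_val).mem_nhds hxW] with z hz
  refine ⟨leOfHom i' hz, ?_⟩
  dsimp only
  rw [← TopCat.Presheaf.germ_res_apply F i z.1 hz s, h, TopCat.Presheaf.germ_res_apply]

/-- A continuous section of the étale space of a sheaf comes from a section of the sheaf. -/
lemma exists_section_of_continuous (F : Shv k Y) (σ : Y → TopCat.Presheaf.EtaleSpace F.obj)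
    (hσ : Continuous σ) (hb : ∀ y, (σ y).base = y) :
    ∃ s : F.obj.obj (op ⊤), ∀ y, σ y = ⟨y, TopCat.Presheaf.germ F.obj ⊤ y trivial s⟩ := by
  have h1 : ∀ y : Y, ∃ (N : Opens Y) (_ : y ∈ N) (s : F.obj.obj (op N)),
      ∀ z (hz : z ∈ N), σ z = ⟨z, TopCat.Presheaf.germ F.obj N z hz s⟩ := by
    intro y
    obtain ⟨U, hyU, f, hf⟩ := TopCat.Presheaf.EtaleSpace.exists_section_of_tendsto (hσ.tendsto y)
    obtain ⟨N, hN, hNo, hyN⟩ := mem_nhds_iff.1 hf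
    have hNU : (⟨N, hNo⟩ : Opens Y) ≤ U := fun z hz => by
      obtain ⟨h, -⟩ := hN hz
      exact hb z ▸ h
    refine ⟨⟨N, hNo⟩, hyN, F.obj.map (homOfLE hNU).op f, fun z hz => ?_⟩
    obtain ⟨h, h'⟩ := hN hz
    have h2 := hb z
    revert h h' h2
    generalize σ z = e
    rintro h h' rfl
    cases e
    congr 1
    exact h'.trans (TopCat.Presheaf.germ_res_apply F.obj (homOfLE hNU) _ hz f).symm
  choose N hyN s hs using h1
  obtain ⟨r, hr, -⟩ := TopCat.Sheaf.existsUnique_gluing' F N ⊤ (fun y => homOfLE le_top)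
    (fun y _ => Opens.mem_iSup.2 ⟨y, hyN y⟩) s (by
      intro x y
      refine TopCat.Presheaf.section_ext F _ _ _ fun z hz => ?_
      have h := (hs x z hz.1).symm.trans (hs y z hz.2)
      simp only [TopCat.Presheaf.EtaleSpace.mk.injEq, heq_eq_eq, true_and] at h
      exact (TopCat.Presheaf.germ_res_apply F.obj _ z hz _).trans
        (h.trans (TopCat.Presheaf.germ_res_apply F.obj _ z hz _).symm))
  refine ⟨r, fun y => ?_⟩
  rw [hs y y (hyN y), ← hr y]
  congr 1
  exact TopCat.Presheaf.germ_res_apply F.obj _ y (hyN y) _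

/-- A locally constant sheaf on a simply connected space is constant. -/
lemma IsSimplyConn.connConst [LocallyConnectedSpace Y] (hY : IsSimplyConn Y) (F : Shv k Y)
    (hF : IsLocConst k Y F) : ConnConst F.obj ⊤ := by
  have hcov : IsCoveringMap (TopCat.Presheaf.EtaleSpace.base (F := F.obj)) := by
    refine TopCat.Presheaf.EtaleSpace.isCoveringMap_base fun y => ?_
    obtain ⟨V, hyV, hV⟩ := (isLocConst_iff_connConst F).1 hF y
    obtain ⟨W, hWV, hyW, hW⟩ := exists_isConnected_le V y hyV
    exact ⟨W, hyW, fun z hz => (hV.mono hWV).bijective_germ hW z hz⟩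
  obtain ⟨I, _, _, h, hh⟩ := hY.trivial_of_isCoveringMap _ _ hcov
  have := hY.connectedSpace
  -- In the trivialisation `Y × I` of the étale space, a section over a connected set has constant
  -- index.
  have hconst : ∀ (A : Opens Y), IsConnected (A : Set Y) → ∀ (s : F.obj.obj (op A)),
      ∃ i : I, ∀ x : A, h ⟨x.1, TopCat.Presheaf.germ F.obj A x.1 x.2 s⟩ = (x.1, i) := by
    intro A hA s
    have : ConnectedSpace A := isConnected_iff_connectedSpace.1 hA
    have hc := (continuous_snd.comp h.continuous).comp (continuous_etaleSection F.obj s)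
    have hl := (IsLocallyConstant.iff_continuous _).2 hc
    obtain ⟨x0⟩ := (inferInstance : Nonempty A)
    refine ⟨_, fun x => Prod.ext (hh _) (hl.apply_eq_of_preconnectedSpace x x0)⟩
  -- Injective: equality on `A` forces equal indices, hence equal germs everywhere. Surjective: the
  -- index of a section over `A` defines a constant slice, which is a global section.
  have htop : ∀ (A : Opens Y), IsConnected (A : Set Y) →
      IsIso (F.obj.map (homOfLE (le_top : A ≤ ⊤)).op) := by
    intro A hA
    rw [ConcreteCategory.isIso_iff_bijective]
    obtain ⟨x0, hx0⟩ := hA.nonempty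
    constructor
    · intro s s' he
      have htop : IsConnected ((⊤ : Opens Y) : Set Y) := by
        simpa using isConnected_univ (α := Y)
      obtain ⟨i, hi⟩ := hconst ⊤ htop s
      obtain ⟨i', hi'⟩ := hconst ⊤ htop s'
      have e1 : TopCat.Presheaf.germ F.obj ⊤ x0 trivial s =
          TopCat.Presheaf.germ F.obj ⊤ x0 trivial s' := by
        rw [← TopCat.Presheaf.germ_res_apply F.obj (homOfLE (le_top : A ≤ ⊤)) x0 hx0 s, he,
          TopCat.Presheaf.germ_res_apply]
      have e2 : i = i' := by
        have := (hi ⟨x0, trivial⟩).symm.trans ((congrArg (fun t => h ⟨x0, t⟩) e1).trans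
          (hi' ⟨x0, trivial⟩))
        exact congrArg Prod.snd this
      subst e2
      refine TopCat.Presheaf.section_ext F _ _ _ fun z hz => ?_
      have := h.injective ((hi ⟨z, trivial⟩).trans (hi' ⟨z, trivial⟩).symm)
      simpa only [TopCat.Presheaf.EtaleSpace.mk.injEq, heq_eq_eq, true_and] using this
    · intro s
      obtain ⟨i, hi⟩ := hconst A hA s
      have hb : ∀ y, (h.symm (y, i)).base = y := fun y => by rw [← hh]; simp
      obtain ⟨r, hr⟩ := exists_section_of_continuous F (fun y => h.symm (y, i))
        (h.symm.continuous.comp (by fun_prop)) hb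
      refine ⟨r, TopCat.Presheaf.section_ext F _ _ _ fun z hz => ?_⟩
      rw [TopCat.Presheaf.germ_res_apply]
      have := (hr z).symm.trans ((h.symm_apply_eq).2 (hi ⟨z, hz⟩).symm)
      simpa only [TopCat.Presheaf.EtaleSpace.mk.injEq, heq_eq_eq, true_and] using this
  intro A B hBA _ hA hB
  have h1 := htop A hA
  have h2 := htop B hB
  refine @IsIso.of_isIso_fac_left _ _ _ _ _ _ _ _ h1 h2 ?_
  rw [← Functor.map_comp]
  rfl

lemma IsSimplyConn.essImage [LocallyConnectedSpace Y] (hY : IsSimplyConn Y) (F : Shv k Y)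
    (hF : IsLocConst k Y F) : (constSheaf k Y).essImage F :=
  have := hY.connectedSpace
  (hY.connConst F hF).essImage

end etale

end TopShv

end

/-! ### Sheets of a map and extension by zero -/

noncomputable section

namespace TopShv

variable (k : Type u) [Ring k]

section sheets
variable {E X : TopCat.{u}} (f : E ⟶ X)

/-- The open subsets of the source which `f` maps bijectively onto `U`. -/
abbrev Sheet (U : Opens X) : Type u :=
  {W : Opens E // Set.InjOn f W ∧ f '' W = U}

variable {f}

/-- The restriction of a sheet to a smaller open subset. -/
def Sheet.res {U V : Opens X} (W : Sheet f U) (h : V ≤ U) : Sheet f V :=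
  ⟨W.1 ⊓ (Opens.map f).obj V, W.2.1.mono fun _ hx => hx.1, by
    ext x
    constructor
    · rintro ⟨y, hy, rfl⟩; exact hy.2
    · intro hx
      obtain ⟨y, hy, rfl⟩ : x ∈ f '' W.1 := by rw [W.2.2]; exact h hx
      exact ⟨y, ⟨hy, hx⟩, rfl⟩⟩

lemma Sheet.res_le {U V : Opens X} (W : Sheet f U) (h : V ≤ U) : (W.res h).1 ≤ W.1 := inf_le_left

lemma Sheet.res_self {U : Opens X} (W : Sheet f U) : W.res le_rfl = W := by
  refine Subtype.ext (inf_eq_left.2 fun x hx => ?_)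
  have : f x ∈ f '' W.1 := ⟨x, hx, rfl⟩
  rw [W.2.2] at this
  exact this

lemma Sheet.res_res {U V V' : Opens X} (W : Sheet f U) (h : V ≤ U) (h' : V' ≤ V) :
    (W.res h).res h' = W.res (h'.trans h) := by
  refine Subtype.ext (Opens.ext ?_)
  ext x
  exact ⟨fun hx => ⟨hx.1.1, hx.2⟩, fun hx => ⟨⟨hx.1, h' hx.2⟩, hx.2⟩⟩

lemma Sheet.eq_res_of_le {U V : Opens X} (W : Sheet f U) (W' : Sheet f V) (h : V ≤ U)
    (hW : W'.1 ≤ W.1) : W' = W.res h := by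
  refine Subtype.ext (Opens.ext ?_)
  ext x
  constructor
  · intro hx
    refine ⟨hW hx, ?_⟩
    have : f x ∈ f '' W'.1 := ⟨x, hx, rfl⟩
    rw [W'.2.2] at this
    exact this
  · rintro ⟨hx, hx'⟩
    have : f x ∈ f '' W'.1 := by rw [W'.2.2]; exact hx'
    obtain ⟨y, hy, hyx⟩ := this
    exact W.2.1 (hW hy) hx hyx ▸ hy

variable {k} in
-- Moves between summands whose indices are equal only propositionally, as needed for the
-- functoriality of `sheetPresheaf`.
lemma Sheet.map_ι (F : (Opens E)ᵒᵖ ⥤ ModuleCat.{u} k) {U : Opens X} {W W' : Sheet f U} (e : W' = W)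
    (h : W'.1 ≤ W.1) :
    F.map (homOfLE h).op ≫ Sigma.ι (fun W : Sheet f U => F.obj (op W.1)) W' =
      Sigma.ι (fun W : Sheet f U => F.obj (op W.1)) W := by
  subst e
  refine Eq.trans ?_ (Category.id_comp _)
  congr 1
  exact F.map_id _

variable {k} (f)

/-- The restriction maps of the presheaf `U ↦ ∐ F(W)`, with `W` running over the sheets of `f`
over `U`. -/
def sheetMap (F : (Opens E)ᵒᵖ ⥤ ModuleCat.{u} k) {U V : Opens X} (h : V ≤ U) :
    (∐ fun W : Sheet f U => F.obj (op W.1)) ⟶ ∐ fun W : Sheet f V => F.obj (op W.1) :=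
  Sigma.desc fun W => F.map (homOfLE (W.res_le h)).op ≫
    Sigma.ι (fun W : Sheet f V => F.obj (op W.1)) (W.res h)

lemma ι_sheetMap (F : (Opens E)ᵒᵖ ⥤ ModuleCat.{u} k) {U V : Opens X} (h : V ≤ U) (W : Sheet f U) :
    Sigma.ι (fun W : Sheet f U => F.obj (op W.1)) W ≫ sheetMap f F h =
      F.map (homOfLE (W.res_le h)).op ≫
        Sigma.ι (fun W : Sheet f V => F.obj (op W.1)) (W.res h) :=
  Sigma.ι_desc _ _

lemma map_map_homOfLE (F : (Opens E)ᵒᵖ ⥤ ModuleCat.{u} k) {U V W : Opens E} (h : V ≤ U)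
    (h' : W ≤ V) :
    F.map (homOfLE h).op ≫ F.map (homOfLE h').op = F.map (homOfLE (h'.trans h)).op := by
  rw [← F.map_comp]; rfl

/-- The presheaf `U ↦ ∐ F(W)`, with `W` running over the sheets of `f` over `U`. -/
def sheetPresheaf : ((Opens E)ᵒᵖ ⥤ ModuleCat.{u} k) ⥤ ((Opens X)ᵒᵖ ⥤ ModuleCat.{u} k) where
  obj F :=
    { obj U := ∐ fun W : Sheet f U.unop => F.obj (op W.1)
      map i := sheetMap f F (leOfHom i.unop)
      map_id U := by
        refine Sigma.hom_ext _ _ fun W => ?_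
        rw [ι_sheetMap, Sheet.map_ι F W.res_self, Category.comp_id]
      map_comp i j := by
        refine Sigma.hom_ext _ _ fun W => ?_
        rw [ι_sheetMap, reassoc_of% ι_sheetMap, ι_sheetMap, reassoc_of% map_map_homOfLE,
          ← Sheet.map_ι F (W.res_res (leOfHom i.unop) (leOfHom j.unop))
            (W.res_res (leOfHom i.unop) (leOfHom j.unop) ▸ le_rfl), reassoc_of% map_map_homOfLE] }
  map η :=
    { app U := Limits.Sigma.map fun W : Sheet f U.unop => η.app (op W.1)
      naturality U V i := by
        refine Sigma.hom_ext _ _ fun W => ?_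
        rw [reassoc_of% ι_sheetMap, Sigma.ι_map, Sigma.ι_map_assoc, ι_sheetMap, η.naturality_assoc] }
  map_id F := by
    ext U : 2
    refine Sigma.hom_ext _ _ fun W => ?_
    simp
  map_comp η θ := by
    ext U : 2
    refine Sigma.hom_ext _ _ fun W => ?_
    simp

lemma mono_sigmaMap {I : Type u} {P Q : I → ModuleCat.{u} k} (g : ∀ i, P i ⟶ Q i)
    (hg : ∀ i, Mono (g i)) : Mono (Limits.Sigma.map g) := by
  have : Mono (Discrete.natTrans (fun i => g i.as) :
      Discrete.functor P ⟶ Discrete.functor Q) := by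
    have (i : Discrete I) : Mono ((Discrete.natTrans (fun i => g i.as) :
      Discrete.functor P ⟶ Discrete.functor Q).app i) := hg i.as
    exact NatTrans.mono_of_mono_app _
  exact inferInstanceAs (Mono ((colim (J := Discrete I) (C := ModuleCat.{u} k)).map
    (Discrete.natTrans (fun i => g i.as) : Discrete.functor P ⟶ Discrete.functor Q)))

instance : (sheetPresheaf (k := k) f).PreservesMonomorphisms where
  preserves η _ := by
    have (U : (Opens X)ᵒᵖ) : Mono (((sheetPresheaf f).map η).app U) :=
      mono_sigmaMap (fun W : Sheet f U.unop => η.app (op W.1)) fun W => inferInstance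
    exact NatTrans.mono_of_mono_app _

/-- The extension by zero functor along a local homeomorphism. -/
def extZero : Shv k E ⥤ Shv k X :=
  sheafToPresheaf _ _ ⋙ sheetPresheaf f ⋙ presheafToSheaf _ _

/-- Coproducts of modules and sheafification both preserve monomorphisms. This is the reason inverse
image along a covering preserves injectives. -/
instance : (extZero (k := k) f).PreservesMonomorphisms := by
  have h1 : (sheafToPresheaf (Opens.grothendieckTopology E)
    (ModuleCat.{u} k)).PreservesMonomorphisms :=
    Functor.preservesMonomorphisms_of_adjunction (sheafificationAdjunction _ _)
  have h2 : (presheafToSheaf (Opens.grothendieckTopology X)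
    (ModuleCat.{u} k)).PreservesMonomorphisms := inferInstance
  have h3 := Functor.preservesMonomorphisms_comp (sheetPresheaf (k := k) f)
    (presheafToSheaf (Opens.grothendieckTopology X) (ModuleCat.{u} k))
  exact @Functor.preservesMonomorphisms_comp _ _ _ _ _ _ _ _ h1 h3

end sheets

end TopShv

end

/-! ### The adjunction between extension by zero and inverse image -/

noncomputable section

namespace TopShv

variable {k : Type u} [Ring k]

section sheetAdjunction
variable {E X : TopCat.{u}} {f : E ⟶ X} (hf : IsLocalHomeomorph f)

/-- The comparison of the sections of `G` over `U` with those of its inverse image over a sheet. -/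
def sheetComparison (G : Shv k X) {U : Opens X} (W : Sheet f U) :
    G.obj.obj (op U) ⟶ ((invImage k f).obj G).obj.obj (op W.1) :=
  G.obj.map (homOfLE (show hf.isOpenMap.functor.obj W.1 ≤ U from W.2.2.le)).op ≫
    (toInvImage k hf.isOpenMap G).app (op W.1)

instance (G : Shv k X) {U : Opens X} (W : Sheet f U) : IsIso (sheetComparison hf G W) := by
  have h1 := isIso_toInvImage_app k hf.isOpenMap G W.1 W.2.1
  have h2 : IsIso (homOfLE (show hf.isOpenMap.functor.obj W.1 ≤ U from W.2.2.le)) :=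
    ⟨homOfLE W.2.2.ge, rfl, rfl⟩
  unfold sheetComparison
  infer_instance

lemma sheetComparison_res (G : Shv k X) {U V : Opens X} (h : V ≤ U) (W : Sheet f U)
    (W' : Sheet f V) (hW : W'.1 ≤ W.1) :
    G.obj.map (homOfLE h).op ≫ sheetComparison hf G W' =
      sheetComparison hf G W ≫ ((invImage k f).obj G).obj.map (homOfLE hW).op := by
  have := (toInvImage k hf.isOpenMap G).naturality (homOfLE hW).op
  refine Eq.trans ?_ ((congrArg (fun t => G.obj.map (homOfLE (show hf.isOpenMap.functor.obj W.1 ≤ U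
    from W.2.2.le)).op ≫ t) this).trans (Category.assoc _ _ _).symm)
  refine (Category.assoc _ _ _).symm.trans (Eq.trans ?_ (Category.assoc _ _ _))
  refine congrArg (fun t => t ≫ (toInvImage k hf.isOpenMap G).app (op W'.1)) ?_
  exact (map_map_homOfLE G.obj _ _).trans (map_map_homOfLE G.obj _ _).symm

lemma sheetComparison_naturality {G G' : Shv k X} (g : G ⟶ G') {U : Opens X} (W : Sheet f U) :
    g.hom.app (op U) ≫ sheetComparison hf G' W =
      sheetComparison hf G W ≫ ((invImage k f).map g).hom.app (op W.1) := by
  have := congrArg (fun t => t.app (op W.1)) (toInvImage_naturality k hf.isOpenMap g)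
  refine Eq.trans ?_ ((congrArg (fun t => G.obj.map (homOfLE (show hf.isOpenMap.functor.obj W.1 ≤ U
    from W.2.2.le)).op ≫ t) this).trans (Category.assoc _ _ _).symm)
  refine (Category.assoc _ _ _).symm.trans (Eq.trans ?_ (Category.assoc _ _ _))
  exact congrArg (fun t => t ≫ (toInvImage k hf.isOpenMap G').app (op W.1))
    (g.hom.naturality _).symm

include hf in
lemma isBasis_injOn :
    Opens.IsBasis (Set.range fun W : {W : Opens E // Set.InjOn f W} => W.1) := by
  rw [Opens.isBasis_iff_nbhd]
  intro U x hx
  obtain ⟨e, hxe, he⟩ := hf x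
  refine ⟨⟨e.source, e.open_source⟩ ⊓ U, ⟨⟨_, ?_⟩, rfl⟩, ⟨hxe, hx⟩, inf_le_right⟩
  rw [he]
  exact e.injOn.mono fun _ h => h.1

/-- A subset on which `f` is injective is a sheet over its image. -/
def imageSheet (W : Opens E) (hW : Set.InjOn f W) : Sheet f (hf.isOpenMap.functor.obj W) :=
  ⟨W, hW, rfl⟩

/-- This and the next three lemmas paste the commutative squares occurring in the adjunction, stated
in an arbitrary category. -/
lemma comp_two_squares {C : Type*} [Category* C] {A A' B B' D D' : C} {i : A ⟶ B} {s : B ⟶ B'}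
    {m : A ⟶ A'} {i' : A' ⟶ B'} {α : B' ⟶ D} {b : A' ⟶ D'} {c : D' ⟶ D} (h1 : i ≫ s = m ≫ i')
    (h2 : i' ≫ α = b ≫ c) : i ≫ s ≫ α = (m ≫ b) ≫ c := by
  rw [reassoc_of% h1, h2, Category.assoc]

lemma comp_naturality {C : Type*} [Category* C] {A B D D' H H' : C} {i : A ⟶ B} {α : B ⟶ D}
    {g : D ⟶ D'} {κ' : D' ⟶ H'} {κ : D ⟶ H} {n : H ⟶ H'} (h : g ≫ κ' = κ ≫ n) :
    i ≫ (α ≫ g) ≫ κ' = (i ≫ α ≫ κ) ≫ n := by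
  rw [Category.assoc, h, Category.assoc, Category.assoc]

lemma comp_desc_naturality {C : Type*} [Category* C] {A A' B B' D D' H H' : C} {i : A ⟶ B}
    {s : B ⟶ B'} {m : A ⟶ A'} {i' : A' ⟶ B'} {d' : B' ⟶ D'} {d : B ⟶ D} {b : A ⟶ H} {b' : A' ⟶ H'}
    {c : H ⟶ D} {c' : H' ⟶ D'} {n : H ⟶ H'} {g : D ⟶ D'} (h1 : i ≫ s = m ≫ i')
    (hd' : i' ≫ d' = b' ≫ c') (h2 : m ≫ b' = b ≫ n) (h4 : c ≫ g = n ≫ c') (hd : i ≫ d = b ≫ c) :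
    i ≫ s ≫ d' = i ≫ d ≫ g := by
  rw [reassoc_of% h1, hd', reassoc_of% h2, ← h4, reassoc_of% hd]

lemma comp_three_squares {C : Type*} [Category* C] {A B D A' B' D' H H' : C} {i : A ⟶ B} {s : B ⟶ B'}
    {m : A ⟶ A'} {i' : A' ⟶ B'} {α : B ⟶ D} {α' : B' ⟶ D'} {g : D ⟶ D'} {κ : D ⟶ H} {κ' : D' ⟶ H'}
    {n : H ⟶ H'} (h1 : i ≫ s = m ≫ i') (h2 : s ≫ α' = α ≫ g) (h3 : g ≫ κ' = κ ≫ n) :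
    m ≫ i' ≫ α' ≫ κ' = (i ≫ α ≫ κ) ≫ n := by
  rw [Category.assoc, Category.assoc, ← h3, ← reassoc_of% h2, reassoc_of% h1]

/-- The component at a sheet of the morphism of sheaves adjoint to `α`. -/
def sheetComponent {F : (Opens E)ᵒᵖ ⥤ ModuleCat.{u} k} {G : Shv k X}
    (α : (sheetPresheaf f).obj F ⟶ G.obj) {U : Opens X} (W : Sheet f U) :
    F.obj (op W.1) ⟶ ((invImage k f).obj G).obj.obj (op W.1) :=
  Sigma.ι (fun W : Sheet f U => F.obj (op W.1)) W ≫ α.app (op U) ≫ sheetComparison hf G W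

lemma sheetComponent_res {F : (Opens E)ᵒᵖ ⥤ ModuleCat.{u} k} {G : Shv k X}
    (α : (sheetPresheaf f).obj F ⟶ G.obj) {U V : Opens X} (h : V ≤ U) (W : Sheet f U)
    (W' : Sheet f V) (hW : W'.1 ≤ W.1) :
    F.map (homOfLE hW).op ≫ sheetComponent hf α W' =
      sheetComponent hf α W ≫ ((invImage k f).obj G).obj.map (homOfLE hW).op := by
  have e := W.eq_res_of_le W' h hW
  subst e
  have h1 : Sigma.ι (fun W : Sheet f U => F.obj (op W.1)) W ≫ sheetMap f F h = _ :=
    ι_sheetMap f F h W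
  have h2 : sheetMap f F h ≫ α.app (op V) = α.app (op U) ≫ G.obj.map (homOfLE h).op :=
    α.naturality (homOfLE h).op
  have h3 := sheetComparison_res hf G h W (W.res h) hW
  exact comp_three_squares h1 h2 h3

/-- The component depends only on the open set `W`: `f '' W` and `U` are equal but not
definitionally so, and restriction along the identity of `W` compares the two. -/
lemma sheetComponent_congr {F : (Opens E)ᵒᵖ ⥤ ModuleCat.{u} k} {G : Shv k X}
    (α : (sheetPresheaf f).obj F ⟶ G.obj) {U : Opens X} (W : Sheet f U) :
    sheetComponent hf α (imageSheet hf W.1 W.2.1) = sheetComponent hf α W := by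
  have h1 := sheetComponent_res hf α W.2.2.le W (imageSheet hf W.1 W.2.1) le_rfl
  have h2 : F.map (homOfLE (le_refl W.1)).op = 𝟙 _ := F.map_id _
  have h3 : ((invImage k f).obj G).obj.map (homOfLE (le_refl W.1)).op = 𝟙 _ :=
    ((invImage k f).obj G).obj.map_id _
  exact (Category.id_comp _).symm.trans ((congrArg (fun t => t ≫ _) h2.symm).trans
    (h1.trans ((congrArg (fun t => _ ≫ t) h3).trans (Category.comp_id _))))

/-- The presheaf version of the adjunction between extension by zero and inverse image, from left
to right. -/
def sheetHomTo {F : Shv k E} {G : Shv k X} (α : (sheetPresheaf f).obj F.obj ⟶ G.obj) :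
    F ⟶ (invImage k f).obj G :=
  -- A morphism into a sheaf is determined by its components on a basis; the open sets on which `f`
  -- is injective form one, and each is a sheet over its image.
  ⟨TopCat.Sheaf.restrictHomEquivHom F.obj ((invImage k f).obj G) (isBasis_injOn hf)
    { app W := sheetComponent hf α (imageSheet hf W.unop.1 W.unop.2)
      naturality W W' i := by
        have h := sheetComponent_res hf α (leOfHom (hf.isOpenMap.functor.map i.unop.hom))
          (imageSheet hf W.unop.1 W.unop.2) (imageSheet hf W'.unop.1 W'.unop.2)
          (leOfHom i.unop.hom)
        exact h }⟩

lemma sheetHomTo_app {F : Shv k E} {G : Shv k X} (α : (sheetPresheaf f).obj F.obj ⟶ G.obj)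
    {U : Opens X} (W : Sheet f U) :
    (sheetHomTo hf α).hom.app (op W.1) = sheetComponent hf α W :=
  (TopCat.Sheaf.extend_hom_app F.obj ((invImage k f).obj G) (isBasis_injOn hf) _
    (⟨W.1, W.2.1⟩ : {W : Opens E // Set.InjOn f W})).trans (sheetComponent_congr hf α W)

/-- The presheaf version of the adjunction between extension by zero and inverse image, from right
to left. -/
def sheetHomFrom {F : Shv k E} {G : Shv k X} (β : F ⟶ (invImage k f).obj G) :
    (sheetPresheaf f).obj F.obj ⟶ G.obj where
  app U := Sigma.desc fun W : Sheet f U.unop =>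
    β.hom.app (op W.1) ≫ inv (sheetComparison hf G W)
  naturality U V i := by
    refine Sigma.hom_ext _ _ fun W => ?_
    have h3 := sheetComparison_res hf G (leOfHom i.unop) W (W.res (leOfHom i.unop)) (W.res_le _)
    have h1 := ι_sheetMap f F.obj (leOfHom i.unop) W
    have h2 := β.hom.naturality (homOfLE (W.res_le (leOfHom i.unop))).op
    have h4 : inv (sheetComparison hf G W) ≫ G.obj.map (homOfLE (leOfHom i.unop)).op =
        ((invImage k f).obj G).obj.map (homOfLE (W.res_le (leOfHom i.unop))).op ≫
          inv (sheetComparison hf G (W.res (leOfHom i.unop))) := by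
      rw [IsIso.inv_comp_eq, ← reassoc_of% h3, IsIso.hom_inv_id, Category.comp_id]
    have h5 (U : Opens X) (W : Sheet f U) : Sigma.ι (fun W : Sheet f U => F.obj.obj (op W.1)) W ≫
        Sigma.desc (fun W : Sheet f U => β.hom.app (op W.1) ≫ inv (sheetComparison hf G W)) =
          β.hom.app (op W.1) ≫ inv (sheetComparison hf G W) := Sigma.ι_desc _ _
    exact comp_desc_naturality h1 (h5 _ _) h2 h4 (h5 _ _)

lemma sheetComponent_sheetHomFrom {F : Shv k E} {G : Shv k X} (β : F ⟶ (invImage k f).obj G)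
    {U : Opens X} (W : Sheet f U) :
    sheetComponent hf (sheetHomFrom hf β) W = β.hom.app (op W.1) := by
  have h : Sigma.ι (fun W : Sheet f U => F.obj.obj (op W.1)) W ≫
      (sheetHomFrom hf β).app (op U) = _ := Sigma.ι_desc _ _
  have h' := (Category.assoc _ _ (sheetComparison hf G W)).symm.trans
    (congrArg (fun t => t ≫ sheetComparison hf G W) h)
  refine h'.trans ?_
  dsimp only
  rw [Category.assoc, IsIso.inv_hom_id]
  exact Category.comp_id _

lemma hom_ext_of_sheets {F : (Opens E)ᵒᵖ ⥤ ModuleCat.{u} k} {G : (Opens X)ᵒᵖ ⥤ ModuleCat.{u} k}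
    {α β : (sheetPresheaf f).obj F ⟶ G}
    (h : ∀ (U : Opens X) (W : Sheet f U), Sigma.ι (fun W : Sheet f U => F.obj (op W.1)) W ≫
      α.app (op U) = Sigma.ι (fun W : Sheet f U => F.obj (op W.1)) W ≫ β.app (op U)) : α = β := by
  ext U : 2
  exact Sigma.hom_ext _ _ fun W => h U.unop W

/-- The presheaf version of the adjunction between extension by zero and inverse image. -/
def sheetHomEquiv (F : Shv k E) (G : Shv k X) :
    ((sheetPresheaf f).obj F.obj ⟶ G.obj) ≃ (F ⟶ (invImage k f).obj G) where
  toFun α := sheetHomTo hf α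
  invFun β := sheetHomFrom hf β
  left_inv α := by
    refine hom_ext_of_sheets fun U W => ?_
    refine (Sigma.ι_desc _ _).trans ?_
    rw [IsIso.comp_inv_eq, sheetHomTo_app]
    exact (Category.assoc _ _ _).symm
  right_inv β := by
    refine Sheaf.hom_ext (TopCat.Sheaf.hom_ext _ _ (isBasis_injOn hf) fun W => ?_)
    exact (sheetHomTo_app hf _ (imageSheet hf W.1 W.2)).trans (sheetComponent_sheetHomFrom hf β _)

lemma sheetHomEquiv_naturality_left {F F' : Shv k E} {G : Shv k X} (a : F ⟶ F')
    (β : F' ⟶ (invImage k f).obj G) :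
    (sheetHomEquiv hf F G).symm (a ≫ β) =
      (sheetPresheaf f).map a.hom ≫ (sheetHomEquiv hf F' G).symm β := by
  refine hom_ext_of_sheets fun U W => (Sigma.ι_desc _ _).trans ?_
  have h1 : Sigma.ι (fun W : Sheet f U => F.obj.obj (op W.1)) W ≫
      ((sheetPresheaf f).map a.hom).app (op U) = a.hom.app (op W.1) ≫
        Sigma.ι (fun W : Sheet f U => F'.obj.obj (op W.1)) W :=
    Limits.Sigma.ι_map (fun W : Sheet f U => a.hom.app (op W.1)) W
  have h2 : Sigma.ι (fun W : Sheet f U => F'.obj.obj (op W.1)) W ≫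
      (sheetHomFrom hf β).app (op U) = β.hom.app (op W.1) ≫ inv (sheetComparison hf G W) :=
    Sigma.ι_desc _ _
  exact (comp_two_squares h1 h2).symm

lemma sheetHomEquiv_naturality_right {F : Shv k E} {G G' : Shv k X}
    (α : (sheetPresheaf f).obj F.obj ⟶ G.obj) (g : G ⟶ G') :
    sheetHomEquiv hf F G' (α ≫ g.hom) = sheetHomEquiv hf F G α ≫ (invImage k f).map g := by
  refine Sheaf.hom_ext (TopCat.Sheaf.hom_ext _ _ (isBasis_injOn hf) fun W => ?_)
  refine (sheetHomTo_app hf _ (imageSheet hf W.1 W.2)).trans ?_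
  refine Eq.trans ?_ (congrArg (fun t => t ≫ _) (sheetHomTo_app hf α (imageSheet hf W.1 W.2)).symm)
  exact comp_naturality (sheetComparison_naturality hf g (imageSheet hf W.1 W.2))

/-- Extension by zero along a local homeomorphism is left adjoint to the inverse image. -/
def extZeroAdj : extZero f ⊣ invImage k f :=
  Adjunction.mkOfHomEquiv
    { homEquiv := fun F G => ((sheafificationAdjunction (Opens.grothendieckTopology X)
        (ModuleCat.{u} k)).homEquiv ((sheetPresheaf f).obj F.obj) G).trans (sheetHomEquiv hf F G)
      homEquiv_naturality_left_symm := fun {F F' G} a β => by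
        have h := congrArg ((sheafificationAdjunction (Opens.grothendieckTopology X)
          (ModuleCat.{u} k)).homEquiv ((sheetPresheaf f).obj F.obj) G).symm
          (sheetHomEquiv_naturality_left hf a β)
        exact h.trans (Adjunction.homEquiv_naturality_left_symm _ _ _)
      homEquiv_naturality_right := fun {F G G'} α g => by
        have h := congrArg (sheetHomEquiv hf F G') ((sheafificationAdjunction
          (Opens.grothendieckTopology X) (ModuleCat.{u} k)).homEquiv_naturality_right α g)
        exact h.trans (sheetHomEquiv_naturality_right hf _ g) }

end sheetAdjunction

end TopShv
end

/-! ### Extension by zero along a covering -/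

noncomputable section

namespace TopShv

variable {k : Type u} [Ring k]

section covering
variable {E X : TopCat.{u}} {f : E ⟶ X}

lemma Sheet.isConnected (hf : IsOpenMap f) {U : Opens X} (W : Sheet f U)
    (hU : IsConnected (U : Set X)) : IsConnected (W.1 : Set E) := by
  have hemb : Topology.IsOpenEmbedding (fun x : W.1 => f x.1) :=
    .of_continuous_injective_isOpenMap (f.hom.continuous.comp continuous_subtype_val)
      (fun x y h => Subtype.ext (W.2.1 x.2 y.2 h)) (hf.comp W.1.isOpen.isOpenMap_subtype_val)
  have hr : (fun x : W.1 => f x.1) '' Set.univ = U := by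
    rw [Set.image_univ]
    refine Eq.trans ?_ W.2.2
    ext x
    simp
  rw [← hr] at hU
  have : IsConnected (Set.univ : Set W.1) :=
    ⟨hU.1.of_image, hemb.isInducing.isPreconnected_image.1 hU.2⟩
  rw [isConnected_iff_connectedSpace]
  exact connectedSpace_iff_univ.2 this

/-- A sheet over a connected set is connected, so its index in the discrete set `I` is constant;
since it maps onto `A`, it fills the whole slice over `A`. -/
lemma Sheet.exists_index (hf : IsOpenMap f) {V : Set X} {I : Type*} [TopologicalSpace I]
    [DiscreteTopology I] (H : f ⁻¹' V ≃ₜ V × I) (hH : ∀ x, (H x).1.1 = f x) {A : Opens X}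
    (hA : IsConnected (A : Set X)) (hAV : (A : Set X) ⊆ V) (W : Sheet f A) :
    ∃ i : I, ∀ x : E, x ∈ W.1 ↔ f x ∈ A ∧ ∃ h : f x ∈ V, (H ⟨x, h⟩).2 = i := by
  have hWA : ∀ x ∈ W.1, f x ∈ A := fun x hx => by
    have : f x ∈ f '' W.1 := ⟨x, hx, rfl⟩
    rwa [W.2.2] at this
  have : ConnectedSpace W.1 := isConnected_iff_connectedSpace.1 (W.isConnected hf hA)
  have hc : Continuous fun x : W.1 => (H ⟨x.1, hAV (hWA x.1 x.2)⟩).2 := by fun_prop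
  have hl := (IsLocallyConstant.iff_continuous _).2 hc
  obtain ⟨x0⟩ := (inferInstance : Nonempty W.1)
  refine ⟨(H ⟨x0.1, hAV (hWA x0.1 x0.2)⟩).2, fun x => ⟨fun hx => ⟨hWA x hx, hAV (hWA x hx),
    hl.apply_eq_of_preconnectedSpace ⟨x, hx⟩ x0⟩, ?_⟩⟩
  rintro ⟨hxA, hxV, hx⟩
  have : f x ∈ f '' W.1 := by rw [W.2.2]; exact hxA
  obtain ⟨w, hw, hwx⟩ := this
  have hw' := hl.apply_eq_of_preconnectedSpace ⟨w, hw⟩ x0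
  have : (⟨w, hAV (hWA w hw)⟩ : f ⁻¹' V) = ⟨x, hxV⟩ :=
    H.injective (Prod.ext (Subtype.ext (by rw [hH, hH]; exact hwx)) (hw'.trans hx.symm))
  obtain rfl : w = x := congrArg Subtype.val this
  exact hw

/-- An index defines a sheet over each open subset of an evenly covered set. -/
lemma exists_sheet_index {V : Set X} {I : Type*} [TopologicalSpace I]
    [DiscreteTopology I] (hV : IsOpen (f ⁻¹' V)) (H : f ⁻¹' V ≃ₜ V × I)
    (hH : ∀ x, (H x).1.1 = f x) (A : Opens X) (hAV : (A : Set X) ⊆ V) (i : I) :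
    ∃ W : Sheet f A, ∀ x : E, x ∈ W.1 ↔ f x ∈ A ∧ ∃ h : f x ∈ V, (H ⟨x, h⟩).2 = i := by
  have ho : IsOpen (Subtype.val '' {x : f ⁻¹' V | (H x).2 = i}) :=
    hV.isOpenMap_subtype_val _ ((isOpen_discrete {i}).preimage (continuous_snd.comp H.continuous))
  let W : Opens E := (Opens.map f).obj A ⊓ ⟨_, ho⟩
  have hmem : ∀ x : E, x ∈ W ↔ f x ∈ A ∧ ∃ h : f x ∈ V, (H ⟨x, h⟩).2 = i := by
    intro x
    constructor
    · rintro ⟨h1, ⟨y, hy⟩, h, rfl⟩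
      exact ⟨h1, hy, h⟩
    · rintro ⟨h1, h2, h3⟩
      exact ⟨h1, ⟨x, h2⟩, h3, rfl⟩
  refine ⟨⟨W, ?_, ?_⟩, hmem⟩
  · intro x hx y hy hxy
    obtain ⟨-, hxV, hxi⟩ := (hmem x).1 hx
    obtain ⟨-, hyV, hyi⟩ := (hmem y).1 hy
    exact congrArg Subtype.val (H.injective (a₁ := ⟨x, hxV⟩) (a₂ := ⟨y, hyV⟩)
      (Prod.ext (Subtype.ext (by rw [hH, hH]; exact hxy)) (hxi.trans hyi.symm)))
  · ext x
    constructor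
    · rintro ⟨y, hy, rfl⟩
      exact ((hmem y).1 hy).1
    · intro hx
      have h1 : f (H.symm (⟨x, hAV hx⟩, i)).1 = x := by rw [← hH]; simp
      refine ⟨(H.symm (⟨x, hAV hx⟩, i)).1, (hmem _).2 ⟨by rwa [h1], ?_, ?_⟩, h1⟩
      · rw [h1]; exact hAV hx
      · simp

/-- Over connected subsets of an evenly covered set, sheets correspond to indices in `I`, and
restriction keeps the index. -/
lemma Sheet.res_bijective (hf : IsOpenMap f) {V : Set X} {I : Type*} [TopologicalSpace I]
    [DiscreteTopology I] (hV : IsOpen (f ⁻¹' V)) (H : f ⁻¹' V ≃ₜ V × I)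
    (hH : ∀ x, (H x).1.1 = f x) {A B : Opens X} (h : B ≤ A) (hAV : (A : Set X) ⊆ V)
    (hA : IsConnected (A : Set X)) (hB : IsConnected (B : Set X)) :
    Function.Bijective fun W : Sheet f A => W.res h := by
  constructor
  · intro W W' hW
    obtain ⟨i, hi⟩ := W.exists_index hf H hH hA hAV
    obtain ⟨i', hi'⟩ := W'.exists_index hf H hH hA hAV
    obtain ⟨x, hx⟩ := ((W.res h).isConnected hf hB).nonempty
    have hx' : x ∈ (W'.res h).1 := by
      have : W.res h = W'.res h := hW
      rwa [← this]
    obtain ⟨-, h1, h2⟩ := (hi x).1 hx.1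
    obtain ⟨-, h3, h4⟩ := (hi' x).1 hx'.1
    have : i = i' := h2.symm.trans h4
    subst this
    exact Subtype.ext (Opens.ext (Set.ext fun y => (hi y).trans (hi' y).symm))
  · intro W
    obtain ⟨i, hi⟩ := W.exists_index hf H hH hB ((show (B : Set X) ⊆ A from h).trans hAV)
    obtain ⟨W', hW'⟩ := exists_sheet_index hV H hH A hAV i
    refine ⟨W', (W'.eq_res_of_le W h fun y hy => ?_).symm⟩
    obtain ⟨h1, h2⟩ := (hi y).1 hy
    exact (hW' y).2 ⟨h h1, h2⟩

/-- Restriction is a bijection between the sets of sheets and an isomorphism on each summand, hence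
an isomorphism of coproducts. -/
lemma connConst_sheetPresheaf (hf : IsOpenMap f) {V : Opens X} {I : Type*} [TopologicalSpace I]
    [DiscreteTopology I] (H : f ⁻¹' V ≃ₜ V × I) (hH : ∀ x, (H x).1.1 = f x)
    {F : (Opens E)ᵒᵖ ⥤ ModuleCat.{u} k} (hF : ConnConst F ⊤) :
    ConnConst ((sheetPresheaf f).obj F) V := by
  intro A B h hAV hA hB
  have hbij := Sheet.res_bijective hf (V.isOpen.preimage f.hom.continuous) H hH h hAV hA hB
  have hiso (W : Sheet f A) : IsIso (F.map (homOfLE (W.res_le h)).op) :=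
    hF _ le_top (W.isConnected hf hA) ((W.res h).isConnected hf hB)
  let e : (∐ fun W : Sheet f A => F.obj (op W.1)) ≅ ∐ fun W : Sheet f B => F.obj (op W.1) :=
    Sigma.whiskerEquiv (Equiv.ofBijective _ hbij) fun W =>
      (asIso (F.map (homOfLE (W.res_le h)).op)).symm
  exact (inferInstance : IsIso e.hom)

lemma isQuasicoherent_extZero [LocallyConnectedSpace X] [LocallyConnectedSpace E]
    (hf : IsCoveringMap f) (M : ModuleCat.{u} k) :
    IsQuasicoherent k X ((extZero f).obj ((constSheaf k E).obj M)) := by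
  refine IsLocConst.isQuasicoherent k ((isLocConst_iff_connConst _).2 fun x => ?_)
  obtain ⟨_, V, hxV, hV, -, H, hH⟩ := hf x
  refine ⟨⟨V, hV⟩, hxV, ?_⟩
  have hF : ConnConst ((constSheaf k E).obj M).obj ⊤ :=
    ConnConst.of_essImage ⟨M, ⟨Iso.refl _⟩⟩ ⊤
  exact (connConst_sheetPresheaf hf.isLocalHomeomorph.isOpenMap (V := ⟨V, hV⟩) H hH hF).of_W
    (F := (extZero f).obj ((constSheaf k E).obj M)) (toSheafify _ _)
    (GrothendieckTopology.W_toSheafify _ _)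

end covering

end TopShv
end

/-! ### Derived functors of composites, and faithfulness of inverse image -/

noncomputable section

namespace TopShv

section derived
variable {C D E : Type*} [Category* C] [Category* D] [Category* E] [Abelian C] [Abelian D] [Abelian E]

/-- The image of an injective resolution under an exact functor that preserves injectives. -/
def mapInjectiveResolution (G : C ⥤ D) [G.Additive] [G.PreservesHomology]
    (hG : ∀ J : C, Injective J → Injective (G.obj J)) {X : C} (I : InjectiveResolution X) :
    InjectiveResolution (G.obj X) where
  cocomplex := (G.mapHomologicalComplex _).obj I.cocomplex
  injective n := hG _ (I.injective n)
  ι := (HomologicalComplex.singleMapHomologicalComplex G (ComplexShape.up ℕ) 0).inv.app X ≫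
    (G.mapHomologicalComplex _).map I.ι
  quasiIso := by
    have : QuasiIso ((G.mapHomologicalComplex (ComplexShape.up ℕ)).map I.ι) := inferInstance
    infer_instance

/-- Right derived functors commute with postcomposition with an exact functor. -/
def rightDerivedCompExactIso [HasInjectiveResolutions C] (F : C ⥤ D) [F.Additive] (P : D ⥤ E)
    [P.Additive] [P.PreservesHomology] (n : ℕ) (X : C) :
    ((F ⋙ P).rightDerived n).obj X ≅ P.obj ((F.rightDerived n).obj X) :=
  (injectiveResolution X).isoRightDerivedObj (F ⋙ P) n ≪≫
    ((((F.mapHomologicalComplex _).obj (injectiveResolution X).cocomplex).sc n).mapHomologyIso P) ≪≫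
    P.mapIso ((injectiveResolution X).isoRightDerivedObj F n).symm

/-- Right derived functors commute with precomposition with an exact functor that preserves
injectives. -/
def rightDerivedExactCompIso [HasInjectiveResolutions C] [HasInjectiveResolutions D]
    (G : C ⥤ D) [G.Additive] [G.PreservesHomology]
    (hG : ∀ J : C, Injective J → Injective (G.obj J)) (F : D ⥤ E) [F.Additive] (n : ℕ) (X : C) :
    ((G ⋙ F).rightDerived n).obj X ≅ (F.rightDerived n).obj (G.obj X) :=
  (injectiveResolution X).isoRightDerivedObj (G ⋙ F) n ≪≫
    ((mapInjectiveResolution G hG (injectiveResolution X)).isoRightDerivedObj F n).symm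

lemma rightDerived_isZero_iff_of_iso [HasInjectiveResolutions C] {F G : C ⥤ D} [F.Additive]
    [G.Additive] (e : F ≅ G) (n : ℕ) (X : C) :
    IsZero ((F.rightDerived n).obj X) ↔ IsZero ((G.rightDerived n).obj X) :=
  Iso.isZero_iff
    { hom := (NatTrans.rightDerived e.hom n).app X
      inv := (NatTrans.rightDerived e.inv n).app X
      hom_inv_id := by
        rw [← NatTrans.comp_app, ← NatTrans.rightDerived_comp, e.hom_inv_id,
          NatTrans.rightDerived_id]; rfl
      inv_hom_id := by
        rw [← NatTrans.comp_app, ← NatTrans.rightDerived_comp, e.inv_hom_id,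
          NatTrans.rightDerived_id]; rfl }

end derived

section coreflective
variable {C D : Type*} [Category* C] [Category* D] {L : C ⥤ D} {R : D ⥤ C}

lemma map_injective_of_essImage (adj : L ⊣ R) [L.Full] [L.Faithful] {X Y : D}
    (hX : L.essImage X) {f g : X ⟶ Y} (h : R.map f = R.map g) : f = g := by
  have := adj.isIso_counit_app_iff_mem_essImage.2 hX
  refine (cancel_epi (adj.counit.app X)).1 ?_
  exact (adj.counit_naturality f).symm.trans
    ((congrArg (fun t => L.map t ≫ adj.counit.app Y) h).trans (adj.counit_naturality g))

end coreflective

section topology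
variable {E X : TopCat.{u}} {f : E ⟶ X}

lemma locallyConnectedSpace_of_isLocalHomeomorph [LocallyConnectedSpace X]
    (hf : IsLocalHomeomorph f) : LocallyConnectedSpace E := by
  rw [locallyConnectedSpace_iff_subsets_isOpen_isConnected]
  intro x U hU
  obtain ⟨U', hU'U, hU', hxU⟩ := mem_nhds_iff.1 hU
  obtain ⟨_, ⟨W, rfl⟩, hxW, hWU⟩ := Opens.isBasis_iff_nbhd.1 (isBasis_injOn hf)
    (show x ∈ (⟨U', hU'⟩ : Opens E) from hxU)
  obtain ⟨A, hA, hxA, hAc⟩ := exists_isConnected_le (hf.isOpenMap.functor.obj W.1) (f x)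
    ⟨x, hxW, rfl⟩
  refine ⟨((imageSheet hf W.1 W.2).res hA).1, ?_, ((imageSheet hf W.1 W.2).res hA).1.isOpen,
    ⟨hxW, hxA⟩, Sheet.isConnected hf.isOpenMap _ hAc⟩
  exact fun y hy => hU'U (hWU hy.1)

lemma surjective_of_isCoveringMap (hf : IsCoveringMap f) [ConnectedSpace X] [Nonempty E] :
    Function.Surjective f := by
  rw [← Set.range_eq_univ]
  refine IsClopen.eq_univ ⟨⟨?_⟩, hf.isLocalHomeomorph.isOpenMap.isOpen_range⟩ (Set.range_nonempty _)
  rw [isOpen_iff_mem_nhds]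
  intro x hx
  obtain ⟨_, V, hxV, hV, -, H, hH⟩ := hf x
  filter_upwards [hV.mem_nhds hxV]
  rintro _ hy ⟨e, rfl⟩
  -- The index set of the trivialisation is the fibre over `x`, so a point `e` above the
  -- neighbourhood yields a point above `x`.
  exact hx ⟨(H ⟨e, hy⟩).2.1, (H ⟨e, hy⟩).2.2⟩

end topology

section faithful
variable {k : Type u} [Ring k] {E X : TopCat.{u}} {f : E ⟶ X}

lemma isBasis_image_injOn (hf : IsLocalHomeomorph f) (hs : Function.Surjective f) :
    Opens.IsBasis (Set.range fun W : {W : Opens E // Set.InjOn f W} =>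
      hf.isOpenMap.functor.obj W.1) := by
  rw [Opens.isBasis_iff_nbhd]
  intro U x hx
  obtain ⟨y, rfl⟩ := hs x
  obtain ⟨_, ⟨W, rfl⟩, hxW, hWU⟩ := Opens.isBasis_iff_nbhd.1 (isBasis_injOn hf)
    (show y ∈ (Opens.map f).obj U from hx)
  refine ⟨_, ⟨W, rfl⟩, ⟨y, hxW, rfl⟩, ?_⟩
  rintro _ ⟨z, hz, rfl⟩
  exact hWU hz

/-- By surjectivity the images of sheets form a basis of `X`, and on them `G` has the same sections
as its inverse image on the sheet. -/
lemma invImage_map_injective (hf : IsLocalHomeomorph f) (hs : Function.Surjective f)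
    {F G : Shv k X} {a b : F ⟶ G} (h : (invImage k f).map a = (invImage k f).map b) : a = b := by
  refine Sheaf.hom_ext (TopCat.Sheaf.hom_ext _ _ (isBasis_image_injOn hf hs) fun W => ?_)
  have h1 := sheetComparison_naturality hf a (imageSheet hf W.1 W.2)
  have h2 := sheetComparison_naturality hf b (imageSheet hf W.1 W.2)
  rw [h, ← h2] at h1
  exact (cancel_mono _).1 h1

/-- Images of connected sets are connected, so `U ↦ F (f '' U)` inherits `ConnConst` before
sheafification. -/
lemma IsLocConst.invImage [LocallyConnectedSpace X] [LocallyConnectedSpace E]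
    (hf : IsOpenMap f) {F : Shv k X} (hF : IsLocConst k X F) :
    IsLocConst k E ((invImage k f).obj F) := by
  refine (isLocConst_iff_connConst _).2 fun y => ?_
  obtain ⟨V, hV, hFV⟩ := (isLocConst_iff_connConst F).1 hF (f y)
  refine ⟨(Opens.map f).obj V, hV, ConnConst.of_W (P := hf.functor.op ⋙ F.obj) ?_
    (toInvImage k hf F) (W_toInvImage k hf F)⟩
  intro A B h hA hA' hB
  refine hFV (leOfHom (hf.functor.map (homOfLE h))) ?_
    (hA'.image _ f.hom.continuous.continuousOn) (hB.image _ f.hom.continuous.continuousOn)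
  rintro _ ⟨x, hx, rfl⟩
  exact hA hx

end faithful

end TopShv
end

/-! ### Colimits of quasi-coherent sheaves -/

noncomputable section

namespace TopShv

variable {k : Type u} [Ring k]

section colimits
variable {X : TopCat.{u}} [LocallySimplyConnectedSpace X]

/-- The point is the order of quantifiers: one simply connected `V` serves all quasi-coherent
sheaves, so infinite diagrams can be treated. -/
lemma exists_isSimplyConn_essImage (x : X) : ∃ V : Opens X, x ∈ V ∧
    ConnectedSpace ((Opens.toTopCat X).obj V) ∧
    ∀ F : Shv k X, IsQuasicoherent k X F → (constSheaf k _).essImage ((restrict k V).obj F) := by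
  obtain ⟨V, hxV, -, hV⟩ := LocallySimplyConnectedSpace.exists_isSimplyConn x (⊤ : Opens X) trivial
  refine ⟨V, hxV, hV.connectedSpace, fun F hF => ?_⟩
  exact IsSimplyConn.essImage (Y := (Opens.toTopCat X).obj V) hV _
    (IsLocConst.invImage (f := V.inclusion') V.isOpenEmbedding.isOpenMap (hF.isLocConst k))

/-- On such a `V` the diagram consists of constant sheaves, and the constant sheaf functor is fully
faithful and preserves colimits, so its essential image is closed under them. -/
instance (J : Type u) [SmallCategory J] :
    (IsQuasicoherent k X).IsClosedUnderColimitsOfShape J := by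
  refine .mk' ?_
  rintro _ ⟨G, hG⟩
  refine IsLocConst.isQuasicoherent k fun x => ?_
  obtain ⟨V, hxV, hV, h⟩ := exists_isSimplyConn_essImage (k := k) x
  have := (constFullyFaithful k ((Opens.toTopCat X).obj V)).full
  have := (constFullyFaithful k ((Opens.toTopCat X).obj V)).faithful
  have : PreservesColimitsOfShape J (constSheaf k ((Opens.toTopCat X).obj V)) :=
    (constAdj k _).leftAdjoint_preservesColimits.preservesColimitsOfShape
  have : PreservesColimitsOfShape J (restrict k V) :=
    (invImageAdj k _).leftAdjoint_preservesColimits.preservesColimitsOfShape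
  exact ⟨V, hxV, Functor.essImage.ofIso (preservesColimitIso (restrict k V) G).symm
    (ObjectProperty.prop_colimit _ _ fun j => h _ (hG j))⟩

instance : HasColimitsOfSize.{u, u} (Qcoh k X) :=
  ⟨fun _ _ => inferInstance⟩

instance : PreservesColimitsOfSize.{u, u} (qcohInclusion k X) :=
  ⟨inferInstance⟩

end colimits

lemma IsUniversalCovering.surjective {E X : TopCat.{u}} [ConnectedSpace X] {φ : E ⟶ X}
    (hφ : IsUniversalCovering φ) : Function.Surjective φ :=
  have := hφ.isSimplyConn.connectedSpace
  surjective_of_isCoveringMap hφ.isCoveringMap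

lemma IsUniversalCovering.injective_invImage {E X : TopCat.{u}} {φ : E ⟶ X}
    (hφ : IsUniversalCovering φ) (J : Shv k X) (hJ : Injective J) :
    Injective ((invImage k φ).obj J) :=
  Injective.injective_of_adjoint (extZeroAdj hφ.isCoveringMap.isLocalHomeomorph) J

/-! ### The coreflection and its derived functors -/

section cover
variable {E X : TopCat.{u}} [LocallySimplyConnectedSpace X] {φ : E ⟶ X}

variable (k φ) in
/-- The functor `L ↦ Γ(E, φ⁻¹ L)` on quasi-coherent sheaves. -/
abbrev liftSections : Qcoh k X ⥤ ModuleCat.{u} k :=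
  qcohInclusion k X ⋙ invImage k φ ⋙ globalSections k E

variable (hφ : IsUniversalCovering φ)

include hφ in
lemma IsUniversalCovering.locallyConnectedSpace : LocallyConnectedSpace E :=
  locallyConnectedSpace_of_isLocalHomeomorph hφ.isCoveringMap.isLocalHomeomorph

include hφ in
lemma IsUniversalCovering.essImage {F : Shv k X} (hF : IsQuasicoherent k X F) :
    (constSheaf k E).essImage ((invImage k φ).obj F) :=
  have := hφ.locallyConnectedSpace
  hφ.isSimplyConn.essImage _
    (IsLocConst.invImage hφ.isCoveringMap.isLocalHomeomorph.isOpenMap (hF.isLocConst k))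

include hφ in
-- Inverse image along the surjective `φ` is faithful, and a morphism out of a constant sheaf is
-- determined by its global sections.
lemma IsUniversalCovering.faithful [ConnectedSpace X] : (liftSections k φ).Faithful where
  map_injective {F G a b} h := by
    have := hφ.isSimplyConn.connectedSpace
    have := (constFullyFaithful k E).full
    have := (constFullyFaithful k E).faithful
    refine ObjectProperty.hom_ext _ ?_
    exact invImage_map_injective hφ.isCoveringMap.isLocalHomeomorph hφ.surjective
      (map_injective_of_essImage (constAdj k E) (hφ.essImage F.property) h)

/-- The quasi-coherent sheaf on the base obtained from a module by extending by zero the constant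
sheaf on the universal covering. -/
def IsUniversalCovering.extConst : ModuleCat.{u} k ⥤ Qcoh k X :=
  have := hφ.locallyConnectedSpace
  ObjectProperty.lift _ (constSheaf k E ⋙ extZero φ) fun M =>
    isQuasicoherent_extZero hφ.isCoveringMap M

/-- `Γ(E, φ⁻¹ -)` is right adjoint to the extension by zero of constant sheaves. -/
def IsUniversalCovering.constExtZeroAdj :
    constSheaf k E ⋙ extZero φ ⊣ invImage k φ ⋙ globalSections k E :=
  (constAdj k E).comp (extZeroAdj hφ.isCoveringMap.isLocalHomeomorph)

/-- `Γ(E, φ⁻¹ -)` on quasi-coherent sheaves is right adjoint to the extension by zero of constant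
sheaves. -/
def IsUniversalCovering.extConstAdj : hφ.extConst (k := k) ⊣ liftSections k φ :=
  hφ.constExtZeroAdj.restrictFullyFaithful (.id _) (ObjectProperty.fullyFaithfulι _)
    (iC := 𝟭 _) (iD := qcohInclusion k X) (Iso.refl _) (Iso.refl _)

include hφ in
-- By adjunction, morphisms from φ_!(k_E) to `F` are the elements of Γ(E, φ⁻¹F), and `liftSections`
-- is faithful.
lemma IsUniversalCovering.isSeparator [ConnectedSpace X] :
    IsSeparator (hφ.extConst.obj (ModuleCat.of k k)) := by
  rw [isSeparator_def]
  intro F G a b h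
  have := hφ.faithful (k := k)
  refine (liftSections k φ).map_injective (ModuleCat.hom_ext (LinearMap.ext fun m => ?_))
  let m' : ModuleCat.of k k ⟶ (liftSections k φ).obj F :=
    ModuleCat.ofHom (LinearMap.toSpanSingleton k _ m)
  have := h ((hφ.extConstAdj.homEquiv _ _).symm m')
  rw [← Adjunction.homEquiv_naturality_right_symm, ← Adjunction.homEquiv_naturality_right_symm]
    at this
  have h2 := congrArg (fun t => t (1 : k)) (Equiv.injective _ this)
  have h3 : m' (1 : k) = m := one_smul k m
  have h4 : (liftSections k φ).map a (m' (1 : k)) = (liftSections k φ).map b (m' (1 : k)) := h2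
  rwa [h3] at h4

include hφ in
lemma IsUniversalCovering.isLeftAdjoint_qcohInclusion [ConnectedSpace X] :
    (qcohInclusion k X).IsLeftAdjoint := by
  have h := hφ.isSeparator (k := k)
  have : HasSeparator (Qcoh k X) := ⟨_, h⟩
  -- An abelian category with a separator is well-powered. Quotients correspond to subobjects, so
  -- this provides the size condition of the special adjoint functor theorem.
  have : WellPowered.{u} (Qcoh k X) := inferInstance
  exact isLeftAdjoint_of_preservesColimits_of_isSeparating.{u} h (qcohInclusion k X)

/-- Sections over the universal covering do not change under coreflection. -/
def IsUniversalCovering.compLiftSectionsIso {Qc : Shv k X ⥤ Qcoh k X}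
    (adj : qcohInclusion k X ⊣ Qc) :
    Qc ⋙ liftSections k φ ≅ invImage k φ ⋙ globalSections k E :=
  Adjunction.rightAdjointUniq (hφ.extConstAdj.comp adj) hφ.constExtZeroAdj

instance : (invImage k φ).PreservesHomology := by
  have : PreservesFiniteColimits (invImage k φ) :=
    ⟨fun _ _ _ => (invImageAdj k φ).leftAdjoint_preservesColimits.preservesColimitsOfShape⟩
  infer_instance

lemma epi_of_isIso_square {C : Type*} [Category* C] {A B A' B' : C} {p : A ⟶ B} {i : B ⟶ B'}
    {j : A ⟶ A'} {q : A' ⟶ B'} (h : p ≫ i = j ≫ q) (hj : IsIso j) (hi : IsIso i) (hq : Epi q) :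
    Epi p := by
  rw [(IsIso.eq_comp_inv _).2 h]
  infer_instance

include hφ in
-- An epimorphism in Qcoh stays one among sheaves and after φ⁻¹. Source and target become constant
-- on E, and the faithful constant sheaf functor reflects epimorphisms.
lemma IsUniversalCovering.preservesEpimorphisms : (liftSections k φ).PreservesEpimorphisms where
  preserves {F G} a _ := by
    have := hφ.isSimplyConn.connectedSpace
    have := (constFullyFaithful k E).full
    have := (constFullyFaithful k E).faithful
    have h1 : Epi ((qcohInclusion k X).map a) := inferInstance
    have h2 : Epi ((invImage k φ).map ((qcohInclusion k X).map a)) := inferInstance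
    have h3 := (constAdj k E).isIso_counit_app_iff_mem_essImage.2 (hφ.essImage F.property)
    have h4 := (constAdj k E).isIso_counit_app_iff_mem_essImage.2 (hφ.essImage G.property)
    have h5 := (constAdj k E).counit_naturality ((invImage k φ).map ((qcohInclusion k X).map a))
    have h6 : Epi ((constSheaf k E).map ((liftSections k φ).map a)) := by
      exact epi_of_isIso_square h5 h3 h4 h2
    exact (constSheaf k E).epi_of_epi_map h6

include hφ in
lemma IsUniversalCovering.preservesHomology : (liftSections k φ).PreservesHomology := by
  have := hφ.preservesEpimorphisms (k := k)
  have : PreservesLimitsOfSize.{0, 0} (liftSections k φ) :=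
    (hφ.extConstAdj (k := k)).rightAdjoint_preservesLimits
  exact Functor.preservesHomology_of_preservesEpis_and_kernels _

include hφ in
/-- `Rⁱ Qc (F)` vanishes if and only if `Hⁱ` of the inverse image of `F` on the universal covering
vanishes. -/
lemma IsUniversalCovering.isZero_rightDerivedQc_iff [ConnectedSpace X]
    {Qc : Shv k X ⥤ Qcoh k X} (adj : qcohInclusion k X ⊣ Qc) (i : ℕ) (F : Shv k X) :
    IsZero ((rightDerivedQc adj i).obj F) ↔ IsZero (cohomology k i ((invImage k φ).obj F)) := by
  have := hφ.faithful (k := k)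
  have := hφ.preservesHomology (k := k)
  have : Qc.Additive := adj.right_adjoint_additive
  -- A faithful additive functor reflects zero objects: it detects whether the identity is zero.
  have h1 : IsZero ((rightDerivedQc adj i).obj F) ↔
      IsZero ((liftSections k φ).obj ((Qc.rightDerived i).obj F)) :=
    ⟨fun h => (liftSections k φ).map_isZero h, fun h => by
      rw [IsZero.iff_id_eq_zero] at h ⊢
      refine (liftSections k φ).map_injective ?_
      exact ((liftSections k φ).map_id _).trans (h.trans ((liftSections k φ).map_zero _ _).symm)⟩
  rw [h1, ← (rightDerivedCompExactIso Qc (liftSections k φ) i F).isZero_iff,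
    rightDerived_isZero_iff_of_iso (hφ.compLiftSectionsIso adj) i F,
    (rightDerivedExactCompIso (invImage k φ) hφ.injective_invImage (globalSections k E)
      i F).isZero_iff]
  rfl

end cover

end TopShv
end

theorem mainTheorem3 (k : Type u) [Ring k] (X : TopCat.{u}) [ConnectedSpace X]
    [TopShv.LocallySimplyConnectedSpace X] (X' : TopCat.{u}) (φ : X' ⟶ X)
    (hφ : TopShv.IsUniversalCovering φ) :
    (TopShv.qcohInclusion k X).IsLeftAdjoint ∧
    ∀ (Qc : TopShv.Shv k X ⥤ TopShv.Qcoh k X) (adj : TopShv.qcohInclusion k X ⊣ Qc),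
      TopShv.IsAspherical k φ ↔
        ∀ (i : ℕ), 0 < i → ∀ L : TopShv.Qcoh k X,
          IsZero ((TopShv.rightDerivedQc adj i).obj ((TopShv.qcohInclusion k X).obj L)) := by
  refine ⟨hφ.isLeftAdjoint_qcohInclusion, fun Qc adj => ⟨fun h i hi L => ?_, fun h i hi M => ?_⟩⟩
  · rw [hφ.isZero_rightDerivedQc_iff adj]
    obtain ⟨M, ⟨e⟩⟩ := hφ.essImage L.property
    exact (h i hi M).of_iso (((TopShv.globalSections k X').rightDerived i).mapIso e.symm)
  -- The constant sheaf on `X'` is the inverse image of the constant sheaf on `X`, so the hypothesis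
  -- is applied to the latter.
  · have hL : TopShv.IsQuasicoherent k X ((TopShv.constSheaf k X).obj M) :=
      TopShv.IsLocConst.isQuasicoherent k fun x =>
        ⟨⊤, trivial, TopShv.essImage_invImage k _ ⟨M, ⟨Iso.refl _⟩⟩⟩
    have := (hφ.isZero_rightDerivedQc_iff adj i _).1 (h i hi ⟨_, hL⟩)
    exact this.of_iso (((TopShv.globalSections k X').rightDerived i).mapIso
      ((TopShv.invImageConst k φ).app M).symm)
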